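/- Let $\mathcal M$ be a unital $*$-subalgebra of $M_n(\mathbb C)$ (a finite dimensional von Neumann algebra), equipped with the Hilbert–Schmidt inner product $\langle X,Y\rangle=\mathrm{Tr}(X^*Y)$ and norm $\|X\|_2=\langle X,X\rangle^{1/2}$, and let $\mathcal N\subseteq\mathcal M$ be a unital $*$-subalgebra. Let $\rho,\sigma\in\mathcal M$ be density matrices (positive semidefinite, unit trace) with $\rho$ invertible, and let $\rho_{\mathcal N},\sigma_{\mathcal N}$ be their images under the orthogonal projection of $\mathcal M$ onto $\mathcal N$. Let $\Delta_{\sigma,\rho}(X)=\sigma X\rho^{-1}$ be the relative modular operator on the Hilbert space $\mathcal M$, and $D=\|\Delta_{\sigma,\rho}\|$ its operator norm; define $\Delta_{\sigma_{\mathcal N},\rho_{\mathcal N}}$ on $\mathcal N$ likewise. For $\alpha\in(0,1)$ let $p_\alpha(t)=-t^\alpha$ and $$S_{p_\alpha}(\rho\|\sigma)=\langle\rho^{1/2},\,p_\alpha(\Delta_{\sigma,\rho})\,\rho^{1/2}\rangle,$$ and define $S_{p_\alpha}(\rho_{\mathcal N}\|\sigma_{\mathcal N})$ in the same way in $\mathcal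 N$. Then $S_{p_\alpha}(\rho\|\sigma)=-\mathrm{Tr}(\rho^{1-\alpha}\sigma^\alpha)$, and the following hold. (1) For $0<\beta<1/2$, $$S_{p_\alpha}(\rho\|\sigma)-S_{p_\alpha}(\rho_{\mathcal N}\|\sigma_{\mathcal N})\ \ge\ K^L_{\alpha,\beta}\,\bigl\|\sigma_{\mathcal N}^{\beta}\rho_{\mathcal N}^{-\beta}\rho^{1/2}-\sigma^\beta\rho^{1/2-\beta}\bigr\|_2^{\frac{1+\alpha(1-\beta)}{\beta(1-\beta)}},$$ where, with $q=\alpha(1-\beta)+1-2\beta+2\beta^2$, $$K^L_{\alpha,\beta}=\Bigl(1+\tfrac{\beta}{1-\beta}D\Bigr)^{-\frac{q}{\beta(1-\beta)}}2^{-\frac{q}{\beta(1-\beta)}}\,\frac{\sin\alpha\pi}{\pi}\left(\frac{\pi\beta q}{(1+\alpha(1-\beta))\sin\beta\pi}\right)^{\frac{1+\alpha(1-\beta)}{\beta(1-\beta)}}\left(\frac{q}{2(1-\beta)}\right)^{-2}.$$ (2) For $1/2\le\beta<1$, $$S_{p_\alpha}(\rho\|\sigma)-S_{p_\alpha}(\rho_{\mathcal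 N}\|\sigma_{\mathcal N})\ \ge\ K^U_{\alpha,\beta}\,\bigl\|\sigma_{\mathcal N}^{\beta}\rho_{\mathcal N}^{-\beta}\rho^{1/2}-\sigma^\beta\rho^{1/2-\beta}\bigr\|_2^{\frac{2\beta+\alpha(1-\beta)}{\beta(1-\beta)}},$$ where, with $s=2\beta^2+\alpha(1-\beta)$, $$K^U_{\alpha,\beta}=\Bigl(\tfrac{1-\beta}{\beta}+D\Bigr)^{-\frac{s}{\beta(1-\beta)}}2^{-\frac{s}{\beta(1-\beta)}}\,\frac{\sin\alpha\pi}{\pi}\left(\frac{\pi(1-\beta)s}{(2\beta+\alpha(1-\beta))\sin\beta\pi}\right)^{\frac{2\beta+\alpha(1-\beta)}{\beta(1-\beta)}}\left(\frac{s}{2\beta}\right)^{-2}.$$ (3) In particular, for $\beta=1/2$, $$S_{p_\alpha}(\rho\|\sigma)-S_{p_\alpha}(\rho_{\mathcal N}\|\sigma_{\mathcal N})\ \ge\ K^U_{\alpha}\,\bigl\|\sigma_{\mathcal N}^{1/2}\rho_{\mathcal N}^{-1/2}\rho^{1/2}-\sigma^{1/2}\bigr\|_2^{4+2\alpha},$$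 where $K^U_\alpha=K^U_{\alpha,1/2}=K^L_{\alpha,1/2}$ (the formulas above evaluated at $\beta=1/2$). -/

import Mathlib

open scoped Matrix ComplexOrder

noncomputable section

namespace QuasiEntropy

/-- A unital *-subalgebra `A` of the `n × n` complex matrices, that is, a finite dimensional
von Neumann algebra, to be equipped with the Hilbert-Schmidt inner product. -/
def HS {n : Type*} [Fintype n] [DecidableEq n] (A : StarSubalgebra ℂ (Matrix n n ℂ)) : Type _ := A

section HilbertSchmidt

variable {n : Type*} [Fintype n] [DecidableEq n] (A : StarSubalgebra ℂ (Matrix n n ℂ))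

instance : AddCommGroup (HS A) := inferInstanceAs (AddCommGroup A)

instance : Module ℂ (HS A) := inferInstanceAs (Module ℂ A)

instance : FiniteDimensional ℂ (HS A) :=
  inferInstanceAs (FiniteDimensional ℂ A.toSubalgebra.toSubmodule)

/-- An element of the algebra, read as an element of the Hilbert-Schmidt space. -/
def toHS : A ≃ₗ[ℂ] HS A := LinearEquiv.refl ℂ A

/-- An element of the Hilbert-Schmidt space, read as a matrix. -/
def toMat : HS A →ₗ[ℂ] Matrix n n ℂ :=
  A.toSubalgebra.toSubmodule.subtype ∘ₗ (toHS A).symm.toLinearMap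

/-- The Hilbert-Schmidt inner product `⟨X, Y⟩ = Tr (X* Y)`. -/
@[reducible]
def hsCore : InnerProductSpace.Core ℂ (HS A) where
  inner X Y := ((toMat A X)ᴴ * toMat A Y).trace
  conj_inner_symm X Y := by
    rw [starRingEnd_apply, ← Matrix.trace_conjTranspose, Matrix.conjTranspose_mul,
      Matrix.conjTranspose_conjTranspose]
  re_inner_nonneg X :=
    (RCLike.nonneg_iff.mp (Matrix.posSemidef_conjTranspose_mul_self (toMat A X)).trace_nonneg).1
  add_left X Y Z := by
    simp [Matrix.add_mul]
  smul_left X Y r := by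
    simp
  definite X hX := by
    rw [Matrix.trace_conjTranspose_mul_self_eq_zero_iff] at hX
    exact Subtype.ext hX

instance : NormedAddCommGroup (HS A) := (hsCore A).toNormedAddCommGroup

instance : InnerProductSpace ℂ (HS A) := InnerProductSpace.ofCore (hsCore A).toCore

instance : CompleteSpace (HS A) := FiniteDimensional.complete ℂ (HS A)

end HilbertSchmidt

/-- The Hilbert-Schmidt (Schatten 2-) norm `(Tr (X* X)) ^ (1/2)` of a matrix. -/
def hsNorm {n : Type*} [Fintype n] (X : Matrix n n ℂ) : ℝ := √((Xᴴ * X).trace).re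

/-- The real power `X ^ s` of a positive semidefinite matrix, by functional calculus.
As `0 ^ s = 0` in `ℝ` for `s ≠ 0`, negative powers are powers of the generalized inverse. -/
def mpow {n : Type*} [Fintype n] [DecidableEq n] (X : Matrix n n ℂ) (s : ℝ) : Matrix n n ℂ :=
  cfc (fun x : ℝ => x ^ s) X

theorem mpow_mem {n : Type*} [Fintype n] [DecidableEq n] {A : StarSubalgebra ℂ (Matrix n n ℂ)}
    {X : Matrix n n ℂ} (hX : X ∈ A) (s : ℝ) : mpow X s ∈ A := by
  have hA : IsClosed (A : Set (Matrix n n ℂ)) :=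
    A.toSubalgebra.toSubmodule.closed_of_finiteDimensional
  exact cfc_mem (𝕜' := ℂ) (hs := hA) _ hX

/-- The real power of an element of the algebra `A`, as an element of `A`. -/
def apow {n : Type*} [Fintype n] [DecidableEq n] {A : StarSubalgebra ℂ (Matrix n n ℂ)}
    (X : A) (s : ℝ) : A :=
  ⟨mpow (X : Matrix n n ℂ) s, mpow_mem X.2 s⟩

/-- A density matrix: positive semidefinite with unit trace. -/
def IsDensity {n : Type*} [Fintype n] (ρ : Matrix n n ℂ) : Prop :=
  ρ.PosSemidef ∧ ρ.trace = 1

/-- The subalgebra `N` of `M` as a subspace of the Hilbert-Schmidt space of `M`. -/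
def hsSub {n : Type*} [Fintype n] [DecidableEq n] (M N : StarSubalgebra ℂ (Matrix n n ℂ)) :
    Submodule ℂ (HS M) :=
  N.toSubalgebra.toSubmodule.comap (toMat M)

/-- The tracial conditional expectation from `M` onto its subalgebra `N`: the orthogonal projection
with respect to the Hilbert-Schmidt inner product. -/
def condExp {n : Type*} [Fintype n] [DecidableEq n] (M N : StarSubalgebra ℂ (Matrix n n ℂ))
    (X : M) : N :=
  ⟨toMat M ((hsSub M N).starProjection (toHS M X)),
    Submodule.starProjection_apply_mem (hsSub M N) (toHS M X)⟩

/-- The relative modular operator `X ↦ σ X ρ⁻¹` on the Hilbert space `A`. -/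
def relMod {n : Type*} [Fintype n] [DecidableEq n] (A : StarSubalgebra ℂ (Matrix n n ℂ))
    (σ ρ : A) : HS A →L[ℂ] HS A :=
  LinearMap.toContinuousLinearMap <|
    (toHS A).toLinearMap ∘ₗ LinearMap.mulLeft ℂ σ ∘ₗ LinearMap.mulRight ℂ (apow ρ (-1)) ∘ₗ
      (toHS A).symm.toLinearMap

/-- The `f`-relative quasi-entropy `S_f(ρ‖σ) = ⟨ρ^{1/2}, f(Δ_{σ,ρ}) ρ^{1/2}⟩` of two states of the
algebra `A`, where `Δ_{σ,ρ}` is the relative modular operator. -/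
def quasiEntropy {n : Type*} [Fintype n] [DecidableEq n] (A : StarSubalgebra ℂ (Matrix n n ℂ))
    (f : ℝ → ℝ) (ρ σ : A) : ℝ :=
  (inner ℂ (toHS A (apow ρ (1 / 2))) (cfc f (relMod A σ ρ) (toHS A (apow ρ (1 / 2))))).re

/-- The function `p_α(t) = -t ^ α`. -/
def powFun (α : ℝ) : ℝ → ℝ := fun t => -t ^ α

/-- The constant `K^L_{α,β}`, as a function of `D = ‖Δ_{σ,ρ}‖`. -/
def KL (α β D : ℝ) : ℝ :=
  (1 + β / (1 - β) * D) ^ (-((α * (1 - β) + 1 - 2 * β + 2 * β ^ 2) / (β * (1 - β)))) *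
  2 ^ (-((α * (1 - β) + 1 - 2 * β + 2 * β ^ 2) / (β * (1 - β)))) *
  (Real.sin (α * Real.pi) / Real.pi) *
  (Real.pi * β * (α * (1 - β) + 1 - 2 * β + 2 * β ^ 2) /
    ((1 + α * (1 - β)) * Real.sin (β * Real.pi))) ^ ((1 + α * (1 - β)) / (β * (1 - β))) *
  ((α * (1 - β) + 1 - 2 * β + 2 * β ^ 2) / (2 * (1 - β))) ^ (-2 : ℝ)

/-- The constant `K^U_{α,β}`, as a function of `D = ‖Δ_{σ,ρ}‖`. -/
def KU (α β D : ℝ) : ℝ :=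
  ((1 - β) / β + D) ^ (-((2 * β ^ 2 + α * (1 - β)) / (β * (1 - β)))) *
  2 ^ (-((2 * β ^ 2 + α * (1 - β)) / (β * (1 - β)))) *
  (Real.sin (α * Real.pi) / Real.pi) *
  (Real.pi * (1 - β) * (2 * β ^ 2 + α * (1 - β)) /
    ((2 * β + α * (1 - β)) * Real.sin (β * Real.pi))) ^
      ((2 * β + α * (1 - β)) / (β * (1 - β))) *
  ((2 * β ^ 2 + α * (1 - β)) / (2 * β)) ^ (-2 : ℝ)

end QuasiEntropy

end

/-! Write `T` for the relative modular operator on `M` and `S` for the one on `N`. Right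
multiplication by `ρ_N^{-1/2} ρ^{1/2}` is an isometry `U` of Hilbert–Schmidt spaces that sends
`ρ_N^{1/2}` to `ρ^{1/2}` and satisfies `U* T U = S` (`inner_embedLinear`,
`inner_embedLinear_relMod`). Both the entropy gap and the norm in the bound are then comparisons
between functions of `T` and of `S` on one unit vector `x`.

Both are controlled by the resolvent defect `w_l = U (l + S)⁻¹ x - (l + T)⁻¹ U x`. Completing the
square gives `l ‖w_l‖² ≤ ⟨Ux, (l + T)⁻¹ Ux⟩ - ⟨x, (l + S)⁻¹ x⟩` (`mul_sq_norm_resolventDefect_le`).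
With `t^p = (sin pπ / π) ∫ l^p (1/l - 1/(l + t)) dl`, the choice `p = α` bounds the gap below by a
multiple of `∫ l^{α+1} ‖w_l‖²`, and `p = β` bounds the norm above by a multiple of `∫ l^β ‖w_l‖`.

It remains to bound the second integral by the first. Near `0` and `∞` the bounds `‖w_l‖ ≤ 2/l` and
`‖w_l‖ ≤ 2D/l²` make the tails small; in the middle Cauchy–Schwarz brings in the gap. The cutoffs
are tied to one parameter, over which the bound is optimized (`rpow_optimization`). The regimes of
`β` differ because the weight `l^{2β-1-α}` is estimated differently on the middle interval. -/

/-! ### The integral representation of `x ^ p`, with its constant -/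

open MeasureTheory Set in
/-- Euler's beta integral at `(p, 1 - p)`. -/
theorem integral_rpow_mul_one_sub_rpow {p : ℝ} (hp : p ∈ Ioo (0 : ℝ) 1) :
    ∫ x in Ioo (0 : ℝ) 1, x ^ (p - 1) * (1 - x) ^ (-p) = Real.pi / Real.sin (p * Real.pi) := by
  have h1 : Complex.betaIntegral p ((1 - p : ℝ) : ℂ) =
      ((∫ x in Ioo (0 : ℝ) 1, x ^ (p - 1) * (1 - x) ^ (-p) : ℝ) : ℂ) := by
    rw [Complex.betaIntegral, intervalIntegral.integral_of_le zero_le_one,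
      integral_Ioc_eq_integral_Ioo, ← integral_complex_ofReal]
    refine setIntegral_congr_fun measurableSet_Ioo fun x hx => ?_
    have hx0 : 0 ≤ x := hx.1.le
    have hx1 : 0 ≤ 1 - x := by linarith [hx.2]
    simp only [Complex.ofReal_mul, Complex.ofReal_cpow hx0, Complex.ofReal_cpow hx1]
    push_cast
    congr 2
    ring
  have h2 := ProbabilityTheory.beta_eq_betaIntegralReal p (1 - p) hp.1 (by linarith [hp.2])
  rw [h1, Complex.ofReal_re, ProbabilityTheory.beta, Real.Gamma_mul_Gamma_one_sub] at h2
  rw [← h2, mul_comm p]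
  simp

-- The substitution `u = t / (1 + t)` maps the half-line onto the unit interval and produces Euler's
-- beta integral. This value is the source of the sines in `KL` and `KU`.
open MeasureTheory Set in
theorem integral_rpowIntegrand₀₁_one {p : ℝ} (hp : p ∈ Ioo (0 : ℝ) 1) :
    ∫ t in Ioi (0 : ℝ), Real.rpowIntegrand₀₁ p t 1 = Real.pi / Real.sin (p * Real.pi) := by
  have himg : (fun t : ℝ => t / (1 + t)) '' Ioi 0 = Ioo 0 1 := by
    ext x
    constructor
    · rintro ⟨t, ht, rfl⟩
      have ht' : (0 : ℝ) < t := ht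
      exact ⟨by positivity, by rw [div_lt_one (by positivity)]; linarith⟩
    · rintro ⟨h0, h1⟩
      have h1' : 0 < 1 - x := by linarith
      refine ⟨x / (1 - x), div_pos h0 h1', ?_⟩
      have : 1 + x / (1 - x) = 1 / (1 - x) := by field_simp; ring
      simp only [this]
      field_simp
  have hder : ∀ t ∈ Ioi (0 : ℝ), HasDerivWithinAt (fun t : ℝ => t / (1 + t))
      (1 / (1 + t) ^ 2) (Ioi 0) t := by
    intro t ht
    have ht' : (0 : ℝ) < t := ht
    have h := ((hasDerivAt_id t).div ((hasDerivAt_id t).const_add 1)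
      (by simp only [id]; positivity)).hasDerivWithinAt (s := Ioi 0)
    refine h.congr_deriv ?_
    simp
  have hinj : InjOn (fun t : ℝ => t / (1 + t)) (Ioi 0) := by
    intro s hs t ht h
    have hs' : (0 : ℝ) < s := hs
    have ht' : (0 : ℝ) < t := ht
    have h1 : s * (1 + t) = t * (1 + s) := by
      simpa [div_eq_div_iff (show (1 + s) ≠ 0 by positivity) (show (1 + t) ≠ 0 by positivity)]
        using h
    linarith
  rw [← integral_rpow_mul_one_sub_rpow hp, ← himg,
    integral_image_eq_integral_abs_deriv_smul measurableSet_Ioi hder hinj]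
  refine setIntegral_congr_fun measurableSet_Ioi fun t ht => ?_
  have ht' : (0 : ℝ) < t := ht
  have h1t : (0 : ℝ) < 1 + t := by positivity
  have hsub : 1 - t / (1 + t) = (1 + t)⁻¹ := by field_simp; ring
  simp only [Real.rpowIntegrand₀₁_eq_pow_div hp ht'.le zero_le_one, smul_eq_mul, hsub]
  rw [abs_of_pos (by positivity), Real.div_rpow ht'.le h1t.le, Real.inv_rpow h1t.le,
    Real.rpow_neg h1t.le, inv_inv, Real.rpow_sub_one h1t.ne', add_comm t 1]
  have := (Real.rpow_pos_of_pos h1t p).ne'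
  field_simp

open MeasureTheory Set in
theorem rpow_eq_sin_mul_integral {p x : ℝ} (hp : p ∈ Ioo (0 : ℝ) 1) (hx : 0 ≤ x) :
    x ^ p = Real.sin (p * Real.pi) / Real.pi * ∫ t in Ioi (0 : ℝ), Real.rpowIntegrand₀₁ p t x := by
  have hs : 0 < Real.sin (p * Real.pi) :=
    Real.sin_pos_of_pos_of_lt_pi (mul_pos hp.1 Real.pi_pos)
      (by nlinarith [Real.pi_pos, hp.2])
  rw [Real.integral_rpowIntegrand₀₁_eq_rpow_mul_const hp hx, integral_rpowIntegrand₀₁_one hp]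
  have := Real.pi_pos.ne'
  field_simp

/-! ### Scalar estimates: splitting the integral and optimizing the cutoffs -/

open MeasureTheory Set in
/-- An integral is controlled by power bounds near `0` and `∞` and by an `L²` bound in between. -/
theorem setIntegral_Ioi_le_of_rpow_bounds {β D A B V : ℝ} {h : ℝ → ℝ} (hβ : β ∈ Ioo (0 : ℝ) 1)
    (hA : 0 < A) (hB : 0 < B) (hint : IntegrableOn h (Ioi 0))
    (h0 : ∀ l, 0 < l → 0 ≤ h l) (h1 : ∀ l, 0 < l → h l ≤ 2 * l ^ (β - 1))
    (h2 : ∀ l, 0 < l → h l ≤ 2 * D * l ^ (β - 2))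
    (hV : ∫ l in Ioc A B, h l ^ 2 ≤ V) :
    ∫ l in Ioi 0, h l ≤ 2 * A ^ β / β + 2 * D * B ^ (β - 1) / (1 - β) + √(B * V) := by
  obtain ⟨hβ0, hβ1⟩ := hβ
  have i1 : ∫ l in Ioc 0 A, h l ≤ 2 * A ^ β / β := by
    have hi : IntegrableOn (fun l : ℝ => 2 * l ^ (β - 1)) (Ioc 0 A) :=
      (((intervalIntegrable_iff_integrableOn_Ioc_of_le hA.le).1
        (intervalIntegral.intervalIntegrable_rpow' (by linarith))).const_mul 2)
    refine (setIntegral_mono_on (hint.mono_set Ioc_subset_Ioi_self) hi measurableSet_Ioc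
      fun l hl => h1 l hl.1).trans (le_of_eq ?_)
    rw [integral_const_mul, ← intervalIntegral.integral_of_le hA.le,
      integral_rpow (Or.inl (by linarith)), sub_add_cancel, Real.zero_rpow hβ0.ne']
    ring
  have i3 : ∫ l in Ioi B, h l ≤ 2 * D * B ^ (β - 1) / (1 - β) := by
    have hi : IntegrableOn (fun l : ℝ => 2 * D * l ^ (β - 2)) (Ioi B) :=
      (integrableOn_Ioi_rpow_of_lt (by linarith) hB).const_mul _
    refine (setIntegral_mono_on (hint.mono_set (Ioi_subset_Ioi hB.le)) hi measurableSet_Ioi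
      fun l hl => h2 l (hB.trans hl)).trans (le_of_eq ?_)
    rw [integral_const_mul, integral_Ioi_rpow_of_lt (by linarith) hB,
      show β - 2 + 1 = β - 1 by ring, neg_div, ← div_neg, neg_sub]
    ring
  have i2 : ∫ l in Ioc A B, h l ≤ √(B * V) := by
    have hm : MemLp h (ENNReal.ofReal 2) (volume.restrict (Ioc A B)) := by
      refine MemLp.of_bound
        (hint.mono_set (fun l hl => hA.trans hl.1)).aestronglyMeasurable (2 * A ^ (β - 1)) ?_
      refine ae_restrict_of_forall_mem measurableSet_Ioc fun l hl => ?_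
      have hl0 : 0 < l := hA.trans hl.1
      rw [Real.norm_of_nonneg (h0 l hl0)]
      refine (h1 l hl0).trans ?_
      have := Real.rpow_le_rpow_of_nonpos hA hl.1.le (show β - 1 ≤ 0 by linarith)
      linarith
    have hnn : 0 ≤ᵐ[volume.restrict (Ioc A B)] h :=
      ae_restrict_of_forall_mem measurableSet_Ioc fun l hl => h0 l (hA.trans hl.1)
    have hcs := integral_mul_le_Lp_mul_Lq_of_nonneg (μ := volume.restrict (Ioc A B))
      Real.HolderConjugate.two_two (f := h) (g := fun _ => 1)
      hnn (by filter_upwards with x using zero_le_one) hm (memLp_const 1)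
    simp only [mul_one, ← Real.sqrt_eq_rpow, Real.rpow_two, one_pow] at hcs
    refine hcs.trans ?_
    rw [← Real.sqrt_mul (integral_nonneg fun l => sq_nonneg _)]
    apply Real.sqrt_le_sqrt
    rw [mul_comm B]
    have hv : ∫ _ in Ioc A B, (1 : ℝ) ≤ B := by
      simp only [integral_const, smul_eq_mul, mul_one, measureReal_restrict_apply_univ,
        Real.volume_real_Ioc]
      exact max_le (by linarith) hB.le
    exact mul_le_mul hV hv (integral_nonneg fun _ => zero_le_one)
      ((integral_nonneg fun l => sq_nonneg _).trans hV)
  have hsplit : ∫ l in Ioi 0, h l = (∫ l in Ioc 0 A, h l) + ∫ l in Ioi A, h l := by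
    rw [← setIntegral_union (Ioc_disjoint_Ioi le_rfl) measurableSet_Ioi
      (hint.mono_set Ioc_subset_Ioi_self) (hint.mono_set (Ioi_subset_Ioi hA.le)),
      Ioc_union_Ioi_eq_Ioi hA.le]
  have i4 : ∫ l in Ioi A, h l ≤ (∫ l in Ioc A B, h l) + ∫ l in Ioi B, h l := by
    -- The cutoffs need not be ordered; if `B ≤ A` the middle piece is empty and the tails overlap,
    -- which is harmless as `h ≥ 0`.
    rcases le_total A B with hAB | hAB
    · rw [← setIntegral_union (Ioc_disjoint_Ioi le_rfl) measurableSet_Ioi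
        (hint.mono_set fun l hl => hA.trans hl.1) (hint.mono_set (Ioi_subset_Ioi hB.le)),
        Ioc_union_Ioi_eq_Ioi hAB]
    · rw [Ioc_eq_empty hAB.not_gt, setIntegral_empty, zero_add]
      exact setIntegral_mono_set (hint.mono_set (Ioi_subset_Ioi hB.le))
        (ae_restrict_of_forall_mem measurableSet_Ioi fun l hl => h0 l (hB.trans hl))
        (Ioi_subset_Ioi hAB).eventuallyLE
  linarith

/-- At the critical point `T^{e+k} = ka / (eb)` of the right-hand side the two terms have ratio `k /
e`, so `y` is at most `(e + k) / e` times the first. The exponent `2(e + k)/k` is the one that makes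
`b` appear squared; later `b = √G`. -/
theorem rpow_optimization {a b e k y : ℝ} (ha : 0 < a) (hb : 0 < b) (he : 0 < e) (hk : 0 < k)
    (hy : 0 ≤ y) (h : ∀ T, 0 < T → y ≤ a * T ^ (-k) + b * T ^ e) :
    a ^ (-(2 * e / k)) * (y * (e / (e + k))) ^ (2 * (e + k) / k) * (e / k) ^ (-2 : ℝ) ≤ b ^ 2 := by
  set T : ℝ := (k * a / (e * b)) ^ (e + k)⁻¹ with hT
  have hT0 : 0 < T := by positivity
  have hTe : T ^ e = k * a / (e * b) * T ^ (-k) := by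
    have : T ^ (e + k) = k * a / (e * b) := by
      rw [hT, ← Real.rpow_mul (by positivity), inv_mul_cancel₀ (by positivity), Real.rpow_one]
    rw [← this, ← Real.rpow_add hT0]
    congr 1
    ring
  set X : ℝ := a * T ^ (-k) with hX
  have hX0 : 0 < X := by positivity
  have hXb : b * T ^ e = k / e * X := by rw [hTe, hX]; field_simp
  have hyX : y * (e / (e + k)) ≤ X := by
    have := h T hT0
    rw [hXb] at this
    rw [← mul_div_assoc, div_le_iff₀ (by positivity)]
    have h2 : X + k / e * X = X * (e + k) / e := by field_simp
    rwa [h2, le_div_iff₀ he] at this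
  have hXp : X ^ (2 * (e + k) / k) = a ^ (2 * e / k) * (e / k) ^ 2 * b ^ 2 := by
    have h1 : 2 * (e + k) / k = 2 * e / k + 2 := by field_simp
    have h2 : X = e / k * b * T ^ e := by
      rw [mul_assoc, hXb]; field_simp
    rw [h1, Real.rpow_add hX0, Real.rpow_two]
    nth_rw 2 [h2]
    rw [hX, Real.mul_rpow ha.le (by positivity), ← Real.rpow_mul hT0.le]
    have h3 : -k * (2 * e / k) = -(2 * e) := by field_simp
    have h4 : T ^ (2 * e) = T ^ e * T ^ e := by rw [two_mul, Real.rpow_add hT0]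
    have h5 : (T ^ e) ≠ 0 := by positivity
    rw [h3, Real.rpow_neg hT0.le, h4]
    field_simp
  have hfin : (y * (e / (e + k))) ^ (2 * (e + k) / k) ≤ a ^ (2 * e / k) * (e / k) ^ 2 * b ^ 2 := by
    rw [← hXp]
    exact Real.rpow_le_rpow (by positivity) hyX (by positivity)
  rw [Real.rpow_neg ha.le, Real.rpow_neg (by positivity : (0 : ℝ) ≤ e / k), Real.rpow_two]
  calc _ ≤ (a ^ (2 * e / k))⁻¹ * (a ^ (2 * e / k) * (e / k) ^ 2 * b ^ 2) * ((e / k) ^ 2)⁻¹ := by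
        gcongr
    _ = b ^ 2 := by field_simp

-- On the middle interval `(l^β n)² = l^{2β-1-α} · l^{α+1} n²`, so a bound `κ` on the first factor
-- leaves the integral that the entropy gap controls.
open MeasureTheory Set in
theorem setIntegral_rpow_mul_le {α β D A B κ G : ℝ} {n : ℝ → ℝ} (hβ : β ∈ Ioo (0 : ℝ) 1)
    (hA : 0 < A) (hB : 0 < B) (hκ : 0 ≤ κ)
    (hn0 : ∀ l, 0 < l → 0 ≤ n l) (hn1 : ∀ l, 0 < l → n l ≤ 2 / l)
    (hn2 : ∀ l, 0 < l → n l ≤ 2 * D / l ^ 2)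
    (hint : IntegrableOn (fun l => l ^ β * n l) (Ioi 0))
    (hint2 : IntegrableOn (fun l => l ^ (α + 1) * n l ^ 2) (Ioi 0))
    (hG : ∫ l in Ioi 0, l ^ (α + 1) * n l ^ 2 ≤ G)
    (hl : ∀ l ∈ Ioc A B, l ^ (2 * β - 1 - α) ≤ κ) :
    ∫ l in Ioi 0, l ^ β * n l ≤
      2 * A ^ β / β + 2 * D * B ^ (β - 1) / (1 - β) + √(B * (κ * G)) := by
  refine setIntegral_Ioi_le_of_rpow_bounds hβ hA hB hint
    (fun l hl => mul_nonneg (by positivity) (hn0 l hl)) (fun l hl => ?_) (fun l hl => ?_) ?_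
  · rw [Real.rpow_sub_one hl.ne']
    calc l ^ β * n l ≤ l ^ β * (2 / l) := by gcongr; exact hn1 l hl
      _ = _ := by ring
  · rw [show β - 2 = β - (2 : ℕ) by norm_num, Real.rpow_sub_natCast hl.ne']
    calc l ^ β * n l ≤ l ^ β * (2 * D / l ^ 2) := by gcongr; exact hn2 l hl
      _ = _ := by ring
  · have hpos : ∀ l, 0 < l → 0 ≤ l ^ (α + 1) * n l ^ 2 := fun l hl => by positivity
    have hsub : Ioc A B ⊆ Ioi 0 := fun l hl => hA.trans hl.1
    calc ∫ l in Ioc A B, (l ^ β * n l) ^ 2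
        ≤ ∫ l in Ioc A B, κ * (l ^ (α + 1) * n l ^ 2) := by
          refine integral_mono_of_nonneg (Filter.Eventually.of_forall fun l => sq_nonneg _)
            ((hint2.mono_set hsub).const_mul κ) ?_
          refine ae_restrict_of_forall_mem measurableSet_Ioc fun l hlm => ?_
          have hl0 : 0 < l := hA.trans hlm.1
          have : (l ^ β * n l) ^ 2 = l ^ (2 * β - 1 - α) * (l ^ (α + 1) * n l ^ 2) := by
            rw [← mul_assoc, ← Real.rpow_add hl0, mul_pow, ← Real.rpow_mul_natCast hl0.le]
            congr 2
            push_cast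
            ring
          show (l ^ β * n l) ^ 2 ≤ _
          rw [this]
          exact mul_le_mul_of_nonneg_right (hl l hlm) (hpos l hl0)
      _ = κ * ∫ l in Ioc A B, l ^ (α + 1) * n l ^ 2 := integral_const_mul _ _
      _ ≤ κ * G := by
          refine mul_le_mul_of_nonneg_left (le_trans ?_ hG) hκ
          exact setIntegral_mono_set hint2
            (ae_restrict_of_forall_mem measurableSet_Ioi fun l hl => hpos l hl) hsub.eventuallyLE

open MeasureTheory Set in
theorem KL_mul_rpow_le {α β D G y : ℝ} {n : ℝ → ℝ} (hα : α ∈ Ioo (0 : ℝ) 1)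
    (hβ : β ∈ Ioo (0 : ℝ) (1 / 2)) (hD : 0 ≤ D)
    (hn0 : ∀ l, 0 < l → 0 ≤ n l) (hn1 : ∀ l, 0 < l → n l ≤ 2 / l)
    (hn2 : ∀ l, 0 < l → n l ≤ 2 * D / l ^ 2)
    (hint : IntegrableOn (fun l => l ^ β * n l) (Ioi 0))
    (hint2 : IntegrableOn (fun l => l ^ (α + 1) * n l ^ 2) (Ioi 0))
    (hG0 : 0 < G) (hG : ∫ l in Ioi 0, l ^ (α + 1) * n l ^ 2 ≤ G) (hy0 : 0 ≤ y)
    (hy : y ≤ Real.sin (β * Real.pi) / Real.pi * ∫ l in Ioi 0, l ^ β * n l) :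
    QuasiEntropy.KL α β D * y ^ ((1 + α * (1 - β)) / (β * (1 - β))) ≤
      Real.sin (α * Real.pi) / Real.pi * G := by
  obtain ⟨hα0, hα1⟩ := hα
  obtain ⟨hβ0, hβ2⟩ := hβ
  have hβ1 : 0 < 1 - β := by linarith
  have hpi := Real.pi_pos
  have hsβ : 0 < Real.sin (β * Real.pi) :=
    Real.sin_pos_of_pos_of_lt_pi (by positivity) (by nlinarith)
  have hsα : 0 < Real.sin (α * Real.pi) :=
    Real.sin_pos_of_pos_of_lt_pi (by positivity) (by nlinarith)
  set q := α * (1 - β) + 1 - 2 * β + 2 * β ^ 2 with hq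
  have hq0 : 0 < q := by nlinarith [mul_pos hα0 hβ1, sq_nonneg β]
  have hr0 : 0 < 1 + α * (1 - β) := by positivity
  have hqr : q = 1 + α * (1 - β) - 2 * β * (1 - β) := by rw [hq]; ring
  have key := rpow_optimization (a := 2 * (1 + β / (1 - β) * D) / β) (b := √G)
    (e := q / (2 * β)) (k := 1 - β) (y := y * Real.pi / Real.sin (β * Real.pi))
    (by positivity) (by positivity) (by positivity) hβ1 (by positivity) ?_
  · rw [Real.sq_sqrt hG0.le] at key
    refine le_trans (le_of_eq ?_) (mul_le_mul_of_nonneg_left key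
      (show 0 ≤ Real.sin (α * Real.pi) / Real.pi by positivity))
    have e1 : q / (2 * β) + (1 - β) = (1 + α * (1 - β)) / (2 * β) := by
      rw [hqr]; field_simp; ring
    have e2 : 2 * ((1 + α * (1 - β)) / (2 * β)) / (1 - β) =
        (1 + α * (1 - β)) / (β * (1 - β)) := by field_simp
    have e3 : 2 * (q / (2 * β)) / (1 - β) = q / (β * (1 - β)) := by field_simp
    have e4 : (1 + α * (1 - β)) / (β * (1 - β)) = q / (β * (1 - β)) + 2 := by
      rw [hqr]; field_simp; ring
    have e5 : y * Real.pi / Real.sin (β * Real.pi) *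
        (q / (2 * β) / ((1 + α * (1 - β)) / (2 * β))) =
        β⁻¹ * (Real.pi * β * q / ((1 + α * (1 - β)) * Real.sin (β * Real.pi)) * y) := by
      field_simp
    have e6 : q / (2 * β) / (1 - β) = β⁻¹ * (q / (2 * (1 - β))) := by field_simp
    have e7 : 2 * (1 + β / (1 - β) * D) / β = β⁻¹ * (2 * (1 + β / (1 - β) * D)) := by ring
    -- A factor `β⁻¹` sits in each of the three powers, with exponents that sum to `0`; this
    -- identity lets it cancel.
    have hp : β⁻¹ ^ ((1 + α * (1 - β)) / (β * (1 - β))) =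
        β⁻¹ ^ (q / (β * (1 - β))) * β⁻¹ ^ 2 := by
      rw [e4, Real.rpow_add (by positivity), Real.rpow_two]
    have hZ : 0 < β⁻¹ ^ (q / (β * (1 - β))) := by positivity
    rw [e1, e2, e3, e5, e6, e7, Real.mul_rpow (by positivity) (by positivity),
      Real.mul_rpow (by positivity) (by positivity), Real.mul_rpow (by positivity) (by positivity),
      Real.mul_rpow (by positivity) (by positivity), Real.mul_rpow (by positivity) (by positivity),
      hp, QuasiEntropy.KL, ← hq, Real.rpow_neg (x := β⁻¹) (by positivity),
      Real.rpow_neg (x := β⁻¹) (by positivity), Real.rpow_two]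
    field_simp
  · intro T hT
    -- With `B = T`, this `A` gives both tails the same order: `A^β = B^{β-1} = T^{-(1-β)}`. For `β
    -- < 1/2` the exponent `2β - 1 - α` is negative, so the weight is largest at `A`.
    set A := T ^ (-((1 - β) / β)) with hA
    have hA0 : 0 < A := by positivity
    have hb := setIntegral_rpow_mul_le (α := α) (κ := A ^ (2 * β - 1 - α)) (G := G)
      ⟨hβ0, by linarith⟩ hA0 hT (by positivity) hn0 hn1 hn2 hint hint2 hG
      (fun l hl => Real.rpow_le_rpow_of_nonpos hA0 hl.1.le (by linarith))
    have hy' : y * Real.pi / Real.sin (β * Real.pi) ≤ ∫ l in Ioi 0, l ^ β * n l := by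
      rw [div_le_iff₀ hsβ, ← le_div_iff₀ hpi]
      refine hy.trans (le_of_eq ?_)
      ring
    refine (hy'.trans hb).trans (le_of_eq ?_)
    have a1 : A ^ β = T ^ (-(1 - β)) := by
      rw [hA, ← Real.rpow_mul hT.le]
      congr 1
      field_simp
    have a2 : √(T * (A ^ (2 * β - 1 - α) * G)) = √G * T ^ (q / (2 * β)) := by
      have : T * (A ^ (2 * β - 1 - α) * G) = G * (T ^ (q / (2 * β))) ^ 2 := by
        rw [hA, ← Real.rpow_mul hT.le, ← Real.rpow_mul_natCast hT.le]
        nth_rw 1 [← Real.rpow_one T]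
        rw [← mul_assoc, ← Real.rpow_add hT, mul_comm]
        congr 2
        push_cast
        rw [hq]
        field_simp
        ring
      rw [this, Real.sqrt_mul hG0.le, Real.sqrt_sq (by positivity)]
    rw [a1, a2, show β - 1 = -(1 - β) by ring]
    field_simp

open MeasureTheory Set in
theorem KU_mul_rpow_le {α β D G y : ℝ} {n : ℝ → ℝ} (hα : α ∈ Ioo (0 : ℝ) 1)
    (hβ : β ∈ Ico (1 / 2 : ℝ) 1) (hD : 0 ≤ D)
    (hn0 : ∀ l, 0 < l → 0 ≤ n l) (hn1 : ∀ l, 0 < l → n l ≤ 2 / l)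
    (hn2 : ∀ l, 0 < l → n l ≤ 2 * D / l ^ 2)
    (hint : IntegrableOn (fun l => l ^ β * n l) (Ioi 0))
    (hint2 : IntegrableOn (fun l => l ^ (α + 1) * n l ^ 2) (Ioi 0))
    (hG0 : 0 < G) (hG : ∫ l in Ioi 0, l ^ (α + 1) * n l ^ 2 ≤ G) (hy0 : 0 ≤ y)
    (hy : y ≤ Real.sin (β * Real.pi) / Real.pi * ∫ l in Ioi 0, l ^ β * n l) :
    QuasiEntropy.KU α β D * y ^ ((2 * β + α * (1 - β)) / (β * (1 - β))) ≤
      Real.sin (α * Real.pi) / Real.pi * G := by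
  obtain ⟨hα0, hα1⟩ := hα
  obtain ⟨hβ2, hβ3⟩ := hβ
  have hβ0 : 0 < β := by linarith
  have hβ1 : 0 < 1 - β := by linarith
  have hpi := Real.pi_pos
  have hsβ : 0 < Real.sin (β * Real.pi) :=
    Real.sin_pos_of_pos_of_lt_pi (by positivity) (by nlinarith)
  have hsα : 0 < Real.sin (α * Real.pi) :=
    Real.sin_pos_of_pos_of_lt_pi (by positivity) (by nlinarith)
  set q := 2 * β ^ 2 + α * (1 - β) with hq
  have hq0 : 0 < q := by positivity
  have hr0 : 0 < 2 * β + α * (1 - β) := by positivity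
  have hqr : q = 2 * β + α * (1 - β) - 2 * β * (1 - β) := by rw [hq]; ring
  have key := rpow_optimization (a := 2 * ((1 - β) / β + D) / (1 - β)) (b := √G)
    (e := q / (2 * (1 - β))) (k := β) (y := y * Real.pi / Real.sin (β * Real.pi))
    (by positivity) (by positivity) (by positivity) hβ0 (by positivity) ?_
  · rw [Real.sq_sqrt hG0.le] at key
    refine le_trans (le_of_eq ?_) (mul_le_mul_of_nonneg_left key
      (show 0 ≤ Real.sin (α * Real.pi) / Real.pi by positivity))
    have e1 : q / (2 * (1 - β)) + β = (2 * β + α * (1 - β)) / (2 * (1 - β)) := by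
      rw [hqr]; field_simp; ring
    have e2 : 2 * ((2 * β + α * (1 - β)) / (2 * (1 - β))) / β =
        (2 * β + α * (1 - β)) / (β * (1 - β)) := by field_simp
    have e3 : 2 * (q / (2 * (1 - β))) / β = q / (β * (1 - β)) := by field_simp
    have e4 : (2 * β + α * (1 - β)) / (β * (1 - β)) = q / (β * (1 - β)) + 2 := by
      rw [hqr]; field_simp; ring
    have e5 : y * Real.pi / Real.sin (β * Real.pi) *
        (q / (2 * (1 - β)) / ((2 * β + α * (1 - β)) / (2 * (1 - β)))) =
        (1 - β)⁻¹ *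
          (Real.pi * (1 - β) * q / ((2 * β + α * (1 - β)) * Real.sin (β * Real.pi)) * y) := by
      field_simp
    have e6 : q / (2 * (1 - β)) / β = (1 - β)⁻¹ * (q / (2 * β)) := by field_simp
    have e7 : 2 * ((1 - β) / β + D) / (1 - β) = (1 - β)⁻¹ * (2 * ((1 - β) / β + D)) := by ring
    have hp : (1 - β)⁻¹ ^ ((2 * β + α * (1 - β)) / (β * (1 - β))) =
        (1 - β)⁻¹ ^ (q / (β * (1 - β))) * (1 - β)⁻¹ ^ 2 := by
      rw [e4, Real.rpow_add (by positivity), Real.rpow_two]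
    have hZ : 0 < (1 - β)⁻¹ ^ (q / (β * (1 - β))) := by positivity
    rw [e1, e2, e3, e5, e6, e7, Real.mul_rpow (by positivity) (by positivity),
      Real.mul_rpow (by positivity) (by positivity), Real.mul_rpow (by positivity) (by positivity),
      Real.mul_rpow (by positivity) (by positivity), Real.mul_rpow (by positivity) (by positivity),
      hp, QuasiEntropy.KU, ← hq, Real.rpow_neg (x := (1 - β)⁻¹) (by positivity),
      Real.rpow_neg (x := (1 - β)⁻¹) (by positivity), Real.rpow_two]
    field_simp
  · intro T hT
    -- Again the cutoffs balance the tails, `A^β = B^{β-1} = T^{-β}`. Now `2β - 1 ≥ 0`, so the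
    -- weight is split: `l^{2β-1}` is bounded at `B` and `l^{-α}` at `A`.
    set A := T⁻¹ with hA
    have hA0 : 0 < A := by positivity
    set B := T ^ (β / (1 - β)) with hB
    have hB0 : 0 < B := by positivity
    have hb := setIntegral_rpow_mul_le (α := α) (κ := B ^ (2 * β - 1) * A ^ (-α)) (G := G)
      ⟨hβ0, by linarith⟩ hA0 hB0 (by positivity) hn0 hn1 hn2 hint hint2 hG
      (fun l hl => by
        have hl0 : 0 < l := hA0.trans hl.1
        rw [sub_eq_add_neg, Real.rpow_add hl0]
        exact mul_le_mul (Real.rpow_le_rpow hl0.le hl.2 (by linarith))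
          (Real.rpow_le_rpow_of_nonpos hA0 hl.1.le (by linarith)) (by positivity) (by positivity))
    have hy' : y * Real.pi / Real.sin (β * Real.pi) ≤ ∫ l in Ioi 0, l ^ β * n l := by
      rw [div_le_iff₀ hsβ, ← le_div_iff₀ hpi]
      refine hy.trans (le_of_eq ?_)
      ring
    refine (hy'.trans hb).trans (le_of_eq ?_)
    have a1 : A ^ β = T ^ (-β) := by
      rw [hA, Real.inv_rpow hT.le, Real.rpow_neg hT.le]
    have a3 : B ^ (β - 1) = T ^ (-β) := by
      rw [hB, ← Real.rpow_mul hT.le]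
      congr 1
      field_simp
      ring
    have a2 : √(B * (B ^ (2 * β - 1) * A ^ (-α) * G)) = √G * T ^ (q / (2 * (1 - β))) := by
      have : B * (B ^ (2 * β - 1) * A ^ (-α) * G) = G * (T ^ (q / (2 * (1 - β)))) ^ 2 := by
        rw [hA, hB, ← Real.rpow_neg_one T, ← Real.rpow_mul hT.le, ← Real.rpow_mul hT.le,
          ← Real.rpow_mul_natCast hT.le, ← mul_assoc, ← mul_assoc, ← Real.rpow_add hT,
          ← Real.rpow_add hT, mul_comm]
        congr 2
        push_cast
        rw [hq]
        field_simp
        ring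
      rw [this, Real.sqrt_mul hG0.le, Real.sqrt_sq (by positivity)]
    rw [a1, a2, a3]
    field_simp

/-! ### Functional calculus on a finite spectrum -/

section SpectralProjection

variable {A : Type*} [Ring A] [StarRing A] [TopologicalSpace A] [Algebra ℝ A]
  [ContinuousFunctionalCalculus ℝ A IsSelfAdjoint]

open Classical in
/-- The spectral projection of `a` for the (isolated) spectral value `t`. -/
noncomputable def specProj (a : A) (t : ℝ) : A := cfc (Pi.single t 1 : ℝ → ℝ) a

variable {a : A}

theorem cfc_eq_sum_specProj (hfin : (spectrum ℝ a).Finite) (f : ℝ → ℝ) :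
    cfc f a = ∑ t ∈ hfin.toFinset, f t • specProj a t := by
  classical
  have hc : ∀ g : ℝ → ℝ, ContinuousOn g (spectrum ℝ a) := fun g => hfin.continuousOn g
  calc cfc f a = cfc (∑ t ∈ hfin.toFinset, fun x => f t • (Pi.single t 1 : ℝ → ℝ) x) a := by
        refine cfc_congr fun x hx => ?_
        rw [Finset.sum_apply, Finset.sum_eq_single x]
        · simp
        · intro t _ ht
          simp [ht.symm]
        · simp [hx]
    _ = _ := by
        rw [cfc_sum _ _ _ fun i _ => hc _]
        refine Finset.sum_congr rfl fun t _ => ?_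
        rw [cfc_smul _ _ _ (hc _)]
        simp [specProj]

theorem sum_specProj (hfin : (spectrum ℝ a).Finite) (ha : IsSelfAdjoint a) :
    ∑ t ∈ hfin.toFinset, specProj a t = 1 := by
  have := cfc_eq_sum_specProj hfin (fun _ => 1)
  rw [cfc_const_one ℝ a ha] at this
  simpa using this.symm

theorem cfc_mul_specProj (hfin : (spectrum ℝ a).Finite) (f : ℝ → ℝ) (t : ℝ) :
    cfc f a * specProj a t = f t • specProj a t := by
  classical
  have hc : ∀ g : ℝ → ℝ, ContinuousOn g (spectrum ℝ a) := fun g => hfin.continuousOn g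
  rw [specProj, ← cfc_mul _ _ _ (hc _) (hc _), ← cfc_smul _ _ _ (hc _)]
  refine cfc_congr fun x _ => ?_
  by_cases h : x = t
  · subst h; simp
  · simp [h]

theorem specProj_mul_cfc (hfin : (spectrum ℝ a).Finite) (f : ℝ → ℝ) (t : ℝ) :
    specProj a t * cfc f a = f t • specProj a t := by
  rw [← cfc_mul_specProj hfin]
  exact cfc_commute_cfc _ _ _

end SpectralProjection

/-! ### Resolvents of positive operators and of their compressions -/

section Operator

variable {H : Type*} [NormedAddCommGroup H] [InnerProductSpace ℂ H] [CompleteSpace H]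
  [FiniteDimensional ℂ H]

theorem ContinuousLinearMap.finite_real_spectrum (T : H →L[ℂ] H) : (spectrum ℝ T).Finite := by
  rw [← spectrum.preimage_algebraMap ℂ]
  refine Set.Finite.preimage (FaithfulSMul.algebraMap_injective ℝ ℂ).injOn ?_
  have := AlgEquiv.spectrum_eq (Module.End.toContinuousLinearMap (𝕜 := ℂ) H).symm T
  rw [← this]
  exact Module.End.finite_spectrum _

theorem cfc_apply_of_eigenvector {T : H →L[ℂ] H} (hT : IsSelfAdjoint T) (f : ℝ → ℝ) {x : H}
    {t : ℝ} (hx : T x = (t : ℂ) • x) : cfc f T x = (f t : ℂ) • x := by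
  have hfin := T.finite_real_spectrum
  have h1 : ∀ s : ℝ, f s • specProj T s x = f t • specProj T s x := by
    intro s
    have h2 : (specProj T s * T) x = s • specProj T s x := by
      have := specProj_mul_cfc (a := T) hfin (fun x => x) s
      rw [cfc_id' ℝ T hT] at this
      rw [this]
      rfl
    rw [mul_apply_eq_comp, hx, map_smul] at h2
    by_cases hs : s = t
    · rw [hs]
    -- Spectral projections for values other than `t` annihilate the eigenvector.
    · have h3 : ((t : ℂ) - s) • specProj T s x = 0 := by
        rw [sub_smul, h2]
        simp
      have h4 : ((t : ℂ) - s) ≠ 0 := by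
        rw [sub_ne_zero]
        exact_mod_cast Ne.symm hs
      rw [(smul_eq_zero.1 h3).resolve_left h4, smul_zero, smul_zero]
  calc cfc f T x = ∑ s ∈ hfin.toFinset, f s • specProj T s x := by
        rw [cfc_eq_sum_specProj hfin, sum_apply]
        rfl
    _ = ∑ s ∈ hfin.toFinset, f t • specProj T s x := Finset.sum_congr rfl fun s _ => h1 s
    _ = f t • (∑ s ∈ hfin.toFinset, specProj T s) x := by
        rw [sum_apply, Finset.smul_sum]
    _ = (f t : ℂ) • x := by rw [sum_specProj hfin hT]; simp

/-- The resolvent `(l + T)⁻¹`, by functional calculus. -/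
noncomputable def posResolvent (T : H →L[ℂ] H) (l : ℝ) : H →L[ℂ] H :=
  cfc (fun t : ℝ => (l + t)⁻¹) T

theorem ContinuousLinearMap.IsPositive.spectrum_nonneg {T : H →L[ℂ] H} (hT : T.IsPositive) {t : ℝ}
    (ht : t ∈ spectrum ℝ T) : 0 ≤ t :=
  spectrum_nonneg_of_nonneg (ContinuousLinearMap.nonneg_iff_isPositive T |>.2 hT) ht

theorem posResolvent_apply_add {T : H →L[ℂ] H} (hT : T.IsPositive) {l : ℝ} (hl : 0 < l) (x : H) :
    (l : ℂ) • posResolvent T l x + T (posResolvent T l x) = x := by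
  have hc : ∀ g : ℝ → ℝ, ContinuousOn g (spectrum ℝ T) :=
    fun g => T.finite_real_spectrum.continuousOn g
  have h1 : cfc (fun t : ℝ => l + t) T * posResolvent T l = 1 := by
    rw [posResolvent, ← cfc_mul _ _ _ (hc _) (hc _), ← cfc_const_one ℝ T hT.isSelfAdjoint]
    refine cfc_congr fun t ht => ?_
    have := hT.spectrum_nonneg ht
    exact mul_inv_cancel₀ (by positivity)
  rw [cfc_const_add l _ T (hc _) hT.isSelfAdjoint, cfc_id' ℝ T hT.isSelfAdjoint] at h1
  have h2 := congrArg (fun S : H →L[ℂ] H => S x) h1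
  simpa [add_mul, Algebra.algebraMap_eq_smul_one] using h2

/-- Positivity gives `Re ⟨x, (l + T)x⟩ ≥ l‖x‖²`, and Cauchy–Schwarz finishes. This is the resolvent
bound in inverse-free form. -/
theorem ContinuousLinearMap.IsPositive.mul_norm_le {T : H →L[ℂ] H} (hT : T.IsPositive) (l : ℝ)
    (x : H) : l * ‖x‖ ≤ ‖(l : ℂ) • x + T x‖ := by
  by_cases hx : ‖x‖ = 0
  · rw [hx, mul_zero]; positivity
  have hx0 : 0 < ‖x‖ := lt_of_le_of_ne (norm_nonneg x) (Ne.symm hx)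
  have h1 : (inner ℂ x ((l : ℂ) • x + T x)).re = l * ‖x‖ ^ 2 + (inner ℂ x (T x)).re := by
    rw [inner_add_right, inner_smul_right, inner_self_eq_norm_sq_to_K]
    simp [← Complex.ofReal_pow]
  have h2 := hT.re_inner_nonneg_right x
  have h3 : (inner ℂ x ((l : ℂ) • x + T x)).re ≤ ‖x‖ * ‖(l : ℂ) • x + T x‖ :=
    (Complex.re_le_norm _).trans (norm_inner_le_norm _ _)
  have h2' : 0 ≤ (inner ℂ x (T x)).re := h2
  refine le_of_mul_le_mul_left ?_ hx0
  nlinarith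

theorem norm_posResolvent_apply_le {T : H →L[ℂ] H} (hT : T.IsPositive) {l : ℝ} (hl : 0 < l)
    (x : H) : ‖posResolvent T l x‖ ≤ ‖x‖ / l := by
  have := hT.mul_norm_le l (posResolvent T l x)
  rw [posResolvent_apply_add hT hl] at this
  rw [le_div_iff₀ hl]
  linarith

theorem norm_inv_smul_sub_posResolvent_apply_le {T : H →L[ℂ] H} (hT : T.IsPositive) {l D : ℝ}
    (hl : 0 < l) (hD : ∀ x, ‖T x‖ ≤ D * ‖x‖) (hD0 : 0 ≤ D) (x : H) :
    ‖(l : ℂ)⁻¹ • x - posResolvent T l x‖ ≤ D * ‖x‖ / l ^ 2 := by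
  have hl' : (l : ℂ) ≠ 0 := by exact_mod_cast hl.ne'
  have h1 : (l : ℂ)⁻¹ • x - posResolvent T l x = (l : ℂ)⁻¹ • T (posResolvent T l x) := by
    nth_rw 1 [← posResolvent_apply_add hT hl x]
    rw [smul_add, smul_smul, inv_mul_cancel₀ hl', one_smul, add_sub_cancel_left]
  rw [h1, norm_smul, norm_inv, Complex.norm_of_nonneg hl.le]
  calc l⁻¹ * ‖T (posResolvent T l x)‖ ≤ l⁻¹ * (D * (‖x‖ / l)) := by
        gcongr
        exact (hD _).trans (mul_le_mul_of_nonneg_left (norm_posResolvent_apply_le hT hl x) hD0)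
    _ = _ := by field_simp

/-- Spectral decomposition turns the vector-valued integrand into a finite sum of scalar integrands
times fixed vectors, so integrability and the value of the integral follow termwise. -/
theorem rpow_smul_posResolvent_eq_sum {T : H →L[ℂ] H} (hT : T.IsPositive) (p l : ℝ) (x : H) :
    ((l ^ p : ℝ) : ℂ) • ((l : ℂ)⁻¹ • x - posResolvent T l x) =
      ∑ t ∈ T.finite_real_spectrum.toFinset, Real.rpowIntegrand₀₁ p l t • specProj T t x := by
  have h1 : posResolvent T l x =
      ∑ t ∈ T.finite_real_spectrum.toFinset, (l + t)⁻¹ • specProj T t x := by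
    rw [posResolvent, cfc_eq_sum_specProj T.finite_real_spectrum, sum_apply]
    rfl
  have h2 : x = ∑ t ∈ T.finite_real_spectrum.toFinset, specProj T t x := by
    rw [← sum_apply, sum_specProj _ hT.isSelfAdjoint]
    simp
  nth_rw 1 [h2]
  rw [h1, Finset.smul_sum, ← Finset.sum_sub_distrib, Finset.smul_sum]
  refine Finset.sum_congr rfl fun t _ => ?_
  rw [Real.rpowIntegrand₀₁, mul_smul, sub_smul, ← Complex.coe_smul, ← Complex.coe_smul,
    ← Complex.coe_smul (l⁻¹), Complex.ofReal_inv l]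

open MeasureTheory Set in
theorem integrableOn_rpow_smul_posResolvent {T : H →L[ℂ] H} (hT : T.IsPositive) {p : ℝ}
    (hp : p ∈ Ioo (0 : ℝ) 1) (x : H) :
    IntegrableOn (fun l : ℝ => ((l ^ p : ℝ) : ℂ) • ((l : ℂ)⁻¹ • x - posResolvent T l x))
      (Ioi 0) := by
  simp_rw [rpow_smul_posResolvent_eq_sum hT]
  refine integrable_finsetSum _ fun t ht => ?_
  exact (Real.integrableOn_rpowIntegrand₀₁_Ioi hp
    (hT.spectrum_nonneg (by simpa using ht))).smul_const _

open MeasureTheory Set in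
theorem cfc_rpow_apply_eq_integral {T : H →L[ℂ] H} (hT : T.IsPositive) {p : ℝ}
    (hp : p ∈ Ioo (0 : ℝ) 1) (x : H) :
    cfc (fun t : ℝ => t ^ p) T x = (Real.sin (p * Real.pi) / Real.pi) •
      ∫ l in Ioi (0 : ℝ), ((l ^ p : ℝ) : ℂ) • ((l : ℂ)⁻¹ • x - posResolvent T l x) := by
  have h0 : ∀ t ∈ T.finite_real_spectrum.toFinset, 0 ≤ t := fun t ht =>
    hT.spectrum_nonneg (by simpa using ht)
  simp_rw [rpow_smul_posResolvent_eq_sum hT]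
  rw [integral_finsetSum _ fun t ht =>
    (Real.integrableOn_rpowIntegrand₀₁_Ioi hp (h0 t ht)).smul_const _, Finset.smul_sum,
    cfc_eq_sum_specProj T.finite_real_spectrum, sum_apply]
  refine Finset.sum_congr rfl fun t ht => ?_
  rw [integral_smul_const, smul_smul, ← rpow_eq_sin_mul_integral hp (h0 t ht)]
  rfl


variable {K : Type*} [NormedAddCommGroup K] [InnerProductSpace ℂ K] [CompleteSpace K]
  [FiniteDimensional ℂ K]

/-- The defect of intertwining of the resolvents of `T` and of its compression `S` by the
isometry `U`. -/
noncomputable def resolventDefect (T : H →L[ℂ] H) (S : K →L[ℂ] K) (U : K →ₗᵢ[ℂ] H) (x : K)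
    (l : ℝ) : H :=
  U (posResolvent S l x) - posResolvent T l (U x)

variable {T : H →L[ℂ] H} {S : K →L[ℂ] K} {U : K →ₗᵢ[ℂ] H}

theorem norm_compression_apply_le (hTS : ∀ x y, inner ℂ (U x) (T (U y)) = inner ℂ x (S y))
    (x : K) : ‖S x‖ ≤ ‖T‖ * ‖x‖ := by
  by_cases h0 : ‖S x‖ = 0
  · rw [h0]; positivity
  have hpos : 0 < ‖S x‖ := lt_of_le_of_ne (norm_nonneg _) (Ne.symm h0)
  refine le_of_mul_le_mul_left ?_ hpos
  calc ‖S x‖ * ‖S x‖ = ‖inner ℂ (S x) (S x)‖ := by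
        rw [inner_self_eq_norm_sq_to_K]; simp [pow_two]
    _ = ‖inner ℂ (U (S x)) (T (U x))‖ := by rw [hTS]
    _ ≤ ‖U (S x)‖ * ‖T (U x)‖ := norm_inner_le_norm _ _
    _ ≤ ‖S x‖ * (‖T‖ * ‖U x‖) := by
        rw [U.norm_map]
        gcongr
        exact T.le_opNorm _
    _ = _ := by rw [U.norm_map]

theorem norm_resolventDefect_le (hT : T.IsPositive) (hS : S.IsPositive) {x : K} (hx : ‖x‖ = 1)
    {l : ℝ} (hl : 0 < l) : ‖resolventDefect T S U x l‖ ≤ 2 / l := by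
  have h1 := norm_posResolvent_apply_le hS hl x
  have h2 := norm_posResolvent_apply_le hT hl (U x)
  rw [U.norm_map, hx] at h2
  rw [hx] at h1
  refine (norm_sub_le _ _).trans ?_
  rw [U.norm_map]
  calc _ ≤ 1 / l + 1 / l := add_le_add h1 h2
    _ = _ := by ring

theorem resolventDefect_eq (x : K) (l : ℝ) : resolventDefect T S U x l =
    ((l : ℂ)⁻¹ • U x - posResolvent T l (U x)) - U ((l : ℂ)⁻¹ • x - posResolvent S l x) := by
  rw [resolventDefect, map_sub, map_smul]
  abel

/-- Subtracting `1/l` from both resolvents does not change the defect, and each difference decays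
like `l⁻²`. The compression has norm at most `‖T‖`, so one constant serves both. -/
theorem norm_resolventDefect_le_sq (hT : T.IsPositive) (hS : S.IsPositive)
    (hTS : ∀ x y, inner ℂ (U x) (T (U y)) = inner ℂ x (S y)) {x : K} (hx : ‖x‖ = 1)
    {l : ℝ} (hl : 0 < l) : ‖resolventDefect T S U x l‖ ≤ 2 * ‖T‖ / l ^ 2 := by
  have h1 := norm_inv_smul_sub_posResolvent_apply_le hS hl (norm_compression_apply_le hTS)
    (norm_nonneg _) x
  have h2 := norm_inv_smul_sub_posResolvent_apply_le hT hl T.le_opNorm (norm_nonneg _) (U x)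
  rw [U.norm_map, hx] at h2
  rw [hx] at h1
  rw [resolventDefect_eq]
  refine (norm_sub_le _ _).trans ?_
  rw [U.norm_map]
  calc _ ≤ ‖T‖ * 1 / l ^ 2 + ‖T‖ * 1 / l ^ 2 := add_le_add h2 h1
    _ = _ := by ring

/-- The real part of the energy `⟨w, (l + T) w⟩` of the defect is exactly the right-hand side: `U* T
U = S` evaluates the term quadratic in `U r'`, and symmetry of `T` the cross term. Dropping `⟨w, T
w⟩ ≥ 0` leaves `l‖w‖²`. -/
theorem mul_sq_norm_resolventDefect_le (hT : T.IsPositive) (hS : S.IsPositive)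
    (hTS : ∀ x y, inner ℂ (U x) (T (U y)) = inner ℂ x (S y)) (x : K) {l : ℝ} (hl : 0 < l) :
    l * ‖resolventDefect T S U x l‖ ^ 2 ≤
      (inner ℂ (U x) (posResolvent T l (U x))).re - (inner ℂ x (posResolvent S l x)).re := by
  set r := posResolvent T l (U x) with hr
  set r' := posResolvent S l x with hr'
  have hv : (l : ℂ) • r + T r = U x := posResolvent_apply_add hT hl _
  have hv' : (l : ℂ) • r' + S r' = x := posResolvent_apply_add hS hl _
  have hw : resolventDefect T S U x l = U r' - r := rfl
  set w := resolventDefect T S U x l with hwdef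
  have h1 : (inner ℂ w ((l : ℂ) • w + T w)).re = l * ‖w‖ ^ 2 + (inner ℂ w (T w)).re := by
    rw [inner_add_right, inner_smul_right, inner_self_eq_norm_sq_to_K]
    simp [← Complex.ofReal_pow]
  have h2 : 0 ≤ (inner ℂ w (T w)).re := hT.re_inner_nonneg_right w
  have h3 : (l : ℂ) • w + T w = ((l : ℂ) • U r' + T (U r')) - U x := by
    rw [hw, map_sub, ← hv, smul_sub]
    abel
  have h4 : inner ℂ (U r') ((l : ℂ) • U r' + T (U r')) = inner ℂ r' x := by
    rw [inner_add_right, inner_smul_right, hTS, U.inner_map_map, ← inner_smul_right,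
      ← inner_add_right, hv']
  have h5 : inner ℂ r ((l : ℂ) • U r' + T (U r')) = inner ℂ x r' := by
    rw [inner_add_right, inner_smul_right, ← hT.inner_left_eq_inner_right,
      ← U.inner_map_map x r']
    have hvr : inner ℂ (U x) (U r') = inner ℂ ((l : ℂ) • r + T r) (U r') := by rw [hv]
    rw [hvr, inner_add_left, inner_smul_left]
    simp
  have h6 : inner ℂ w ((l : ℂ) • w + T w) = inner ℂ r (U x) - inner ℂ x r' := by
    rw [h3, hw, inner_sub_left, inner_sub_right, inner_sub_right, h4, h5, U.inner_map_map]
    ring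
  have h7 : (inner ℂ (U x) r).re = (inner ℂ r (U x)).re := inner_re_symm (𝕜 := ℂ) _ _
  rw [h6, Complex.sub_re] at h1
  rw [h7]
  linarith

open MeasureTheory Set in
theorem integrableOn_rpow_smul_resolventDefect (hT : T.IsPositive) (hS : S.IsPositive) {p : ℝ}
    (hp : p ∈ Ioo (0 : ℝ) 1) (x : K) :
    IntegrableOn (fun l : ℝ => ((l ^ p : ℝ) : ℂ) • resolventDefect T S U x l) (Ioi 0) := by
  have h := (integrableOn_rpow_smul_posResolvent hT hp (U x)).sub
    (U.toContinuousLinearMap.integrable_comp (integrableOn_rpow_smul_posResolvent hS hp x))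
  refine h.congr (Filter.Eventually.of_forall fun l => ?_)
  simp only [Pi.sub_apply, resolventDefect_eq, smul_sub, map_sub, map_smul,
    LinearIsometry.coe_toContinuousLinearMap]

open MeasureTheory Set in
theorem integrableOn_rpow_mul_norm_resolventDefect (hT : T.IsPositive) (hS : S.IsPositive) {p : ℝ}
    (hp : p ∈ Ioo (0 : ℝ) 1) (x : K) :
    IntegrableOn (fun l : ℝ => l ^ p * ‖resolventDefect T S U x l‖) (Ioi 0) := by
  refine (integrableOn_rpow_smul_resolventDefect (U := U) hT hS hp x).norm.congr ?_
  refine ae_restrict_of_forall_mem measurableSet_Ioi fun l hl => ?_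
  simp only
  rw [norm_smul, Complex.norm_of_nonneg (Real.rpow_nonneg (le_of_lt hl) p)]

open MeasureTheory Set in
theorem norm_cfc_rpow_sub_le (hT : T.IsPositive) (hS : S.IsPositive) {p : ℝ}
    (hp : p ∈ Ioo (0 : ℝ) 1) (x : K) :
    ‖U (cfc (fun t : ℝ => t ^ p) S x) - cfc (fun t : ℝ => t ^ p) T (U x)‖ ≤
      Real.sin (p * Real.pi) / Real.pi *
        ∫ l in Ioi (0 : ℝ), l ^ p * ‖resolventDefect T S U x l‖ := by
  have hs : 0 ≤ Real.sin (p * Real.pi) / Real.pi := by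
    refine div_nonneg (Real.sin_nonneg_of_nonneg_of_le_pi ?_ ?_) Real.pi_pos.le
    · exact mul_nonneg hp.1.le Real.pi_pos.le
    · nlinarith [Real.pi_pos, hp.2]
  have hU : U (cfc (fun t : ℝ => t ^ p) S x) = (Real.sin (p * Real.pi) / Real.pi) •
      ∫ l in Ioi (0 : ℝ), U (((l ^ p : ℝ) : ℂ) • ((l : ℂ)⁻¹ • x - posResolvent S l x)) := by
    rw [cfc_rpow_apply_eq_integral hS hp, ← Complex.coe_smul, map_smul, ← Complex.coe_smul]
    congr 1
    exact (U.toContinuousLinearMap.integral_comp_comm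
      (integrableOn_rpow_smul_posResolvent hS hp x)).symm
  have h : U (cfc (fun t : ℝ => t ^ p) S x) - cfc (fun t : ℝ => t ^ p) T (U x) =
      -((Real.sin (p * Real.pi) / Real.pi) •
        ∫ l in Ioi (0 : ℝ), ((l ^ p : ℝ) : ℂ) • resolventDefect T S U x l) := by
    have hi : IntegrableOn
        (fun l : ℝ => U (((l ^ p : ℝ) : ℂ) • ((l : ℂ)⁻¹ • x - posResolvent S l x))) (Ioi 0) :=
      U.toContinuousLinearMap.integrable_comp (integrableOn_rpow_smul_posResolvent hS hp x)
    rw [hU, cfc_rpow_apply_eq_integral hT hp, ← smul_sub, ← smul_neg, ← neg_sub,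
      ← integral_sub (integrableOn_rpow_smul_posResolvent hT hp (U x)) hi]
    simp only [resolventDefect_eq, smul_sub, map_sub, map_smul]
  rw [h, norm_neg, norm_smul, Real.norm_of_nonneg hs]
  refine mul_le_mul_of_nonneg_left ((norm_integral_le_integral_norm _).trans (le_of_eq ?_)) hs
  refine setIntegral_congr_fun measurableSet_Ioi fun l hl => ?_
  rw [norm_smul, Complex.norm_of_nonneg (Real.rpow_nonneg (le_of_lt hl) p)]

-- Integrates the pointwise defect bound against `l^p`. The `1/l` terms of the two representations
-- cancel since `U` preserves inner products.
open MeasureTheory Set in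
theorem integral_sq_norm_resolventDefect_le (hT : T.IsPositive) (hS : S.IsPositive)
    (hTS : ∀ x y, inner ℂ (U x) (T (U y)) = inner ℂ x (S y)) {p : ℝ}
    (hp : p ∈ Ioo (0 : ℝ) 1) (x : K) :
    IntegrableOn (fun l : ℝ => l ^ (p + 1) * ‖resolventDefect T S U x l‖ ^ 2) (Ioi 0) ∧
    Real.sin (p * Real.pi) / Real.pi *
        ∫ l in Ioi (0 : ℝ), l ^ (p + 1) * ‖resolventDefect T S U x l‖ ^ 2 ≤
      (inner ℂ x (cfc (fun t : ℝ => t ^ p) S x)).re -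
        (inner ℂ (U x) (cfc (fun t : ℝ => t ^ p) T (U x))).re := by
  have hs : 0 ≤ Real.sin (p * Real.pi) / Real.pi := by
    refine div_nonneg (Real.sin_nonneg_of_nonneg_of_le_pi ?_ ?_) Real.pi_pos.le
    · exact mul_nonneg hp.1.le Real.pi_pos.le
    · nlinarith [Real.pi_pos, hp.2]
  have iS := integrableOn_rpow_smul_posResolvent hS hp x
  have iT := integrableOn_rpow_smul_posResolvent hT hp (U x)
  set FS := fun l : ℝ => ((l ^ p : ℝ) : ℂ) • ((l : ℂ)⁻¹ • x - posResolvent S l x) with hFS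
  set FT := fun l : ℝ => ((l ^ p : ℝ) : ℂ) • ((l : ℂ)⁻¹ • U x - posResolvent T l (U x)) with hFT
  have jS : IntegrableOn (fun l => (inner ℂ x (FS l)).re) (Ioi 0) := (iS.const_inner (𝕜 := ℂ) x).re
  have jT : IntegrableOn (fun l => (inner ℂ (U x) (FT l)).re) (Ioi 0) := (iT.const_inner (𝕜 := ℂ) (U x)).re
  have kS : (inner ℂ x (cfc (fun t : ℝ => t ^ p) S x)).re =
      Real.sin (p * Real.pi) / Real.pi * ∫ l in Ioi 0, (inner ℂ x (FS l)).re := by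
    rw [cfc_rpow_apply_eq_integral hS hp, ← Complex.coe_smul, inner_smul_right,
      Complex.re_ofReal_mul, ← integral_inner iS]
    congr 1
    exact (integral_re (iS.const_inner (𝕜 := ℂ) x)).symm
  have kT : (inner ℂ (U x) (cfc (fun t : ℝ => t ^ p) T (U x))).re =
      Real.sin (p * Real.pi) / Real.pi * ∫ l in Ioi 0, (inner ℂ (U x) (FT l)).re := by
    rw [cfc_rpow_apply_eq_integral hT hp, ← Complex.coe_smul, inner_smul_right,
      Complex.re_ofReal_mul, ← integral_inner iT]
    congr 1
    exact (integral_re (iT.const_inner (𝕜 := ℂ) (U x))).symm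
  have hpt : ∀ l ∈ Ioi (0 : ℝ), l ^ (p + 1) * ‖resolventDefect T S U x l‖ ^ 2 ≤
      (inner ℂ x (FS l)).re - (inner ℂ (U x) (FT l)).re := by
    intro l hl
    have hl0 : (0 : ℝ) < l := hl
    have h := mul_sq_norm_resolventDefect_le hT hS hTS x hl0
    have e : (inner ℂ x (FS l)).re - (inner ℂ (U x) (FT l)).re = l ^ p *
        ((inner ℂ (U x) (posResolvent T l (U x))).re - (inner ℂ x (posResolvent S l x)).re) := by
      simp only [hFS, hFT, inner_smul_right, inner_sub_right, Complex.re_ofReal_mul,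
        Complex.sub_re, U.inner_map_map]
      ring
    rw [e, Real.rpow_add_one hl0.ne', mul_assoc]
    exact mul_le_mul_of_nonneg_left h (by positivity)
  have hmeas : AEStronglyMeasurable (fun l : ℝ => l ^ (p + 1) * ‖resolventDefect T S U x l‖ ^ 2)
      (volume.restrict (Ioi 0)) := by
    -- Measurability is read off from `l^{p+1}‖w‖² = l^{1-p} (l^p‖w‖)²`.
    have h1 := ((integrableOn_rpow_mul_norm_resolventDefect (U := U) hT hS hp
      x).aestronglyMeasurable.pow 2)
    have h2 : AEStronglyMeasurable (fun l : ℝ => l ^ (1 - p)) (volume.restrict (Ioi 0)) :=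
      (measurable_id.pow_const _).aestronglyMeasurable
    refine (h2.mul h1).congr (ae_restrict_of_forall_mem measurableSet_Ioi fun l hl => ?_)
    have hl0 : (0 : ℝ) < l := hl
    simp only [Pi.mul_apply, Pi.pow_apply]
    rw [mul_pow, ← Real.rpow_mul_natCast hl0.le, ← mul_assoc, ← Real.rpow_add hl0]
    congr 2
    push_cast
    ring
  have hint : IntegrableOn (fun l : ℝ => l ^ (p + 1) * ‖resolventDefect T S U x l‖ ^ 2)
      (Ioi 0) := by
    refine Integrable.mono' (jS.sub jT) hmeas
      (ae_restrict_of_forall_mem measurableSet_Ioi fun l hl => ?_)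
    have hl0 : (0 : ℝ) < l := hl
    rw [Real.norm_of_nonneg (by positivity)]
    exact hpt l hl
  refine ⟨hint, ?_⟩
  rw [kS, kT, ← mul_sub, ← integral_sub jS jT]
  exact mul_le_mul_of_nonneg_left
    (setIntegral_mono_on hint (jS.sub jT) measurableSet_Ioi hpt) hs

/-- The optimal cutoff divides by `√G`, so `G > 0` is needed, yet the defect integral may vanish. It
is therefore perturbed by `ε / c`. -/
theorem le_of_forall_pos_le_mul_add {c g a I : ℝ} (hc : 0 < c) (hI : c * I ≤ g)
    (hI0 : 0 ≤ I) (h : ∀ G, 0 < G → I ≤ G → a ≤ c * G) : a ≤ g := by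
  refine le_of_forall_pos_le_add fun ε hε => ?_
  have := h (I + ε / c) (by positivity) (by simp; positivity)
  rw [mul_add, mul_div_cancel₀ _ hc.ne'] at this
  linarith

open MeasureTheory Set in
theorem KL_mul_rpow_norm_le (hT : T.IsPositive) (hS : S.IsPositive)
    (hTS : ∀ x y, inner ℂ (U x) (T (U y)) = inner ℂ x (S y)) {α β : ℝ}
    (hα : α ∈ Ioo (0 : ℝ) 1) (hβ : β ∈ Ioo (0 : ℝ) (1 / 2)) {x : K} (hx : ‖x‖ = 1) :
    QuasiEntropy.KL α β ‖T‖ *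
      ‖U (cfc (fun t : ℝ => t ^ β) S x) - cfc (fun t : ℝ => t ^ β) T (U x)‖ ^
        ((1 + α * (1 - β)) / (β * (1 - β))) ≤
      (inner ℂ x (cfc (fun t : ℝ => t ^ α) S x)).re -
        (inner ℂ (U x) (cfc (fun t : ℝ => t ^ α) T (U x))).re := by
  have hsα : 0 < Real.sin (α * Real.pi) / Real.pi :=
    div_pos (Real.sin_pos_of_pos_of_lt_pi (mul_pos hα.1 Real.pi_pos)
      (by nlinarith [Real.pi_pos, hα.2])) Real.pi_pos
  have hβ' : β ∈ Ioo (0 : ℝ) 1 := ⟨hβ.1, by linarith [hβ.2]⟩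
  obtain ⟨h1, h2⟩ := integral_sq_norm_resolventDefect_le hT hS hTS hα x
  refine le_of_forall_pos_le_mul_add hsα h2
    (setIntegral_nonneg measurableSet_Ioi fun l hl => ?_) fun G hG hIG => ?_
  · have hl0 : (0 : ℝ) < l := hl
    positivity
  · exact KL_mul_rpow_le hα hβ (norm_nonneg T) (fun l _ => norm_nonneg _)
      (fun l hl => norm_resolventDefect_le hT hS hx hl)
      (fun l hl => norm_resolventDefect_le_sq hT hS hTS hx hl)
      (integrableOn_rpow_mul_norm_resolventDefect hT hS hβ' x) h1 hG hIG (norm_nonneg _)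
      (norm_cfc_rpow_sub_le hT hS hβ' x)

open MeasureTheory Set in
theorem KU_mul_rpow_norm_le (hT : T.IsPositive) (hS : S.IsPositive)
    (hTS : ∀ x y, inner ℂ (U x) (T (U y)) = inner ℂ x (S y)) {α β : ℝ}
    (hα : α ∈ Ioo (0 : ℝ) 1) (hβ : β ∈ Ico (1 / 2 : ℝ) 1) {x : K} (hx : ‖x‖ = 1) :
    QuasiEntropy.KU α β ‖T‖ *
      ‖U (cfc (fun t : ℝ => t ^ β) S x) - cfc (fun t : ℝ => t ^ β) T (U x)‖ ^
        ((2 * β + α * (1 - β)) / (β * (1 - β))) ≤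
      (inner ℂ x (cfc (fun t : ℝ => t ^ α) S x)).re -
        (inner ℂ (U x) (cfc (fun t : ℝ => t ^ α) T (U x))).re := by
  have hsα : 0 < Real.sin (α * Real.pi) / Real.pi :=
    div_pos (Real.sin_pos_of_pos_of_lt_pi (mul_pos hα.1 Real.pi_pos)
      (by nlinarith [Real.pi_pos, hα.2])) Real.pi_pos
  have hβ' : β ∈ Ioo (0 : ℝ) 1 := ⟨by linarith [hβ.1], hβ.2⟩
  obtain ⟨h1, h2⟩ := integral_sq_norm_resolventDefect_le hT hS hTS hα x
  refine le_of_forall_pos_le_mul_add hsα h2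
    (setIntegral_nonneg measurableSet_Ioi fun l hl => ?_) fun G hG hIG => ?_
  · have hl0 : (0 : ℝ) < l := hl
    positivity
  · exact KU_mul_rpow_le hα hβ (norm_nonneg T) (fun l _ => norm_nonneg _)
      (fun l hl => norm_resolventDefect_le hT hS hx hl)
      (fun l hl => norm_resolventDefect_le_sq hT hS hTS hx hl)
      (integrableOn_rpow_mul_norm_resolventDefect hT hS hβ' x) h1 hG hIG (norm_nonneg _)
      (norm_cfc_rpow_sub_le hT hS hβ' x)

end Operator

/-! ### Matrix powers and the relative modular operator -/

namespace QuasiEntropy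

section Powers

variable {n : Type*} [Fintype n] [DecidableEq n] {X : Matrix n n ℂ}

theorem continuousOn_real_spectrum (X : Matrix n n ℂ) (f : ℝ → ℝ) :
    ContinuousOn f (spectrum ℝ X) :=
  X.finite_real_spectrum.continuousOn f

theorem conjTranspose_mpow (X : Matrix n n ℂ) (s : ℝ) : (mpow X s)ᴴ = mpow X s :=
  cfc_predicate (p := IsSelfAdjoint) (fun x : ℝ => x ^ s) X

theorem spectrum_pos_of_posDef (hX : X.PosDef) {t : ℝ} (ht : t ∈ spectrum ℝ X) : 0 < t := by
  rw [hX.isHermitian.spectrum_real_eq_range_eigenvalues] at ht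
  obtain ⟨i, rfl⟩ := ht
  exact hX.eigenvalues_pos i

theorem spectrum_nonneg_of_posSemidef (hX : X.PosSemidef) {t : ℝ} (ht : t ∈ spectrum ℝ X) :
    0 ≤ t := by
  rw [hX.isHermitian.spectrum_real_eq_range_eigenvalues] at ht
  obtain ⟨i, rfl⟩ := ht
  exact hX.eigenvalues_nonneg i

theorem mpow_zero (hX : X.IsHermitian) : mpow X 0 = 1 := by
  simp only [mpow, Real.rpow_zero]
  exact cfc_const_one ℝ X hX

theorem mpow_one (hX : X.IsHermitian) : mpow X 1 = X := by
  simp only [mpow, Real.rpow_one]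
  exact cfc_id' ℝ X hX

theorem mpow_mul_mpow (hX : X.PosDef) (s t : ℝ) : mpow X s * mpow X t = mpow X (s + t) := by
  rw [mpow, mpow, mpow, ← cfc_mul _ _ _ (continuousOn_real_spectrum _ _)
    (continuousOn_real_spectrum _ _)]
  exact cfc_congr fun x hx => (Real.rpow_add (spectrum_pos_of_posDef hX hx) s t).symm

end Powers

section HilbertSchmidt

variable {n : Type*} [Fintype n] [DecidableEq n] (A : StarSubalgebra ℂ (Matrix n n ℂ))

@[simp]
theorem toMat_toHS (X : A) : toMat A (toHS A X) = (X : Matrix n n ℂ) := rfl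

theorem inner_eq_trace (x y : HS A) : inner ℂ x y = ((toMat A x)ᴴ * toMat A y).trace := rfl

theorem norm_eq_hsNorm (x : HS A) : ‖x‖ = hsNorm (toMat A x) := by
  rw [norm_eq_sqrt_re_inner (𝕜 := ℂ), inner_eq_trace]
  rfl

theorem toMat_mem (x : HS A) : toMat A x ∈ A := ((toHS A).symm x).2

theorem toMat_injective : Function.Injective (toMat A) := fun _ _ h => Subtype.ext h

theorem toMat_relMod (σ ρ : A) (x : HS A) : toMat A (relMod A σ ρ x) =
    (σ : Matrix n n ℂ) * (toMat A x * mpow (ρ : Matrix n n ℂ) (-1)) := rfl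

variable {A}

/-- By cyclicity the quadratic form is `Tr (Y* σ Y)` with `Y = X ρ^{-1/2}`. -/
theorem isPositive_relMod {σ ρ : A} (hσ : (σ : Matrix n n ℂ).PosSemidef)
    (hρ : (ρ : Matrix n n ℂ).PosDef) : (relMod A σ ρ).IsPositive := by
  rw [ContinuousLinearMap.isPositive_iff_complex]
  intro x
  have h : (0 : ℂ) ≤ inner ℂ (relMod A σ ρ x) x := by
    have hps := (hσ.conjTranspose_mul_mul_same
      (toMat A x * mpow (ρ : Matrix n n ℂ) (-1 / 2))).trace_nonneg
    have e : mpow (ρ : Matrix n n ℂ) (-1) =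
        mpow (ρ : Matrix n n ℂ) (-1 / 2) * mpow (ρ : Matrix n n ℂ) (-1 / 2) := by
      rw [mpow_mul_mpow hρ]; norm_num
    rw [inner_eq_trace, toMat_relMod, Matrix.conjTranspose_mul, Matrix.conjTranspose_mul,
      conjTranspose_mpow, hσ.isHermitian.eq, e]
    rw [Matrix.conjTranspose_mul, conjTranspose_mpow] at hps
    refine hps.trans (le_of_eq ?_)
    simp only [Matrix.mul_assoc]
    rw [Matrix.trace_mul_comm (mpow (ρ : Matrix n n ℂ) (-1 / 2))]
    simp only [Matrix.mul_assoc]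
    rw [← Matrix.mul_assoc (mpow (ρ : Matrix n n ℂ) (-1 / 2)),
      Matrix.trace_mul_comm (mpow (ρ : Matrix n n ℂ) (-1 / 2) * _)]
    simp only [Matrix.mul_assoc]
  rw [Complex.le_def] at h
  exact ⟨Complex.ext rfl h.2, h.1⟩

theorem cfc_mem_of_mem {X : Matrix n n ℂ} (hX : X ∈ A) (f : ℝ → ℝ) : cfc f X ∈ A := by
  have hA : IsClosed (A : Set (Matrix n n ℂ)) :=
    A.toSubalgebra.toSubmodule.closed_of_finiteDimensional
  exact cfc_mem (𝕜' := ℂ) (hs := hA) f hX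

/-- Spectral projections, as elements of the algebra. -/
noncomputable def algProj (X : A) (t : ℝ) : A :=
  ⟨specProj (X : Matrix n n ℂ) t, cfc_mem_of_mem X.2 _⟩

theorem apow_mul_algProj (X : A) (s t : ℝ) : apow X s * algProj X t = (t ^ s : ℝ) • algProj X t :=
  Subtype.ext (cfc_mul_specProj (Matrix.finite_real_spectrum (A := (X : Matrix n n ℂ))) _ _)

theorem algProj_mul_apow (X : A) (s t : ℝ) : algProj X t * apow X s = (t ^ s : ℝ) • algProj X t :=
  Subtype.ext (specProj_mul_cfc (Matrix.finite_real_spectrum (A := (X : Matrix n n ℂ))) _ _)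

theorem sum_algProj (X : A) (hX : (X : Matrix n n ℂ).IsHermitian) :
    ∑ t ∈ (Matrix.finite_real_spectrum (A := (X : Matrix n n ℂ))).toFinset, algProj X t = 1 := by
  refine Subtype.ext ?_
  rw [AddSubmonoidClass.coe_finsetSum]
  exact sum_specProj _ hX

/-- If `P_a` and `Q_b` are spectral projections of `σ` and `ρ`, then `P_a X Q_b` satisfies the
eigenvector equation for `a b⁻¹`, and these pieces sum to `X`. They lie in `A`, so the argument
stays inside the algebra. -/
theorem cfc_rpow_relMod {σ ρ : A} (hσ : (σ : Matrix n n ℂ).PosSemidef)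
    (hρ : (ρ : Matrix n n ℂ).PosDef) (s : ℝ) (X : A) :
    cfc (fun t : ℝ => t ^ s) (relMod A σ ρ) (toHS A X) =
      toHS A (apow σ s * X * apow ρ (-s)) := by
  have key : ∀ a ∈ (Matrix.finite_real_spectrum (A := (σ : Matrix n n ℂ))).toFinset,
      ∀ b ∈ (Matrix.finite_real_spectrum (A := (ρ : Matrix n n ℂ))).toFinset,
      cfc (fun t : ℝ => t ^ s) (relMod A σ ρ) (toHS A (algProj σ a * X * algProj ρ b)) =
        toHS A (apow σ s * (algProj σ a * X * algProj ρ b) * apow ρ (-s)) := by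
    intro a ha b hb
    have ha0 : 0 ≤ a := spectrum_nonneg_of_posSemidef hσ (by simpa using ha)
    have hb0 : 0 < b := spectrum_pos_of_posDef hρ (by simpa using hb)
    have hσ1 : apow σ 1 = σ := Subtype.ext (mpow_one hσ.isHermitian)
    have gen : ∀ u v : ℝ, apow σ u * (algProj σ a * X * algProj ρ b) * apow ρ v =
        (a ^ u * b ^ v : ℝ) • (algProj σ a * X * algProj ρ b) := by
      intro u v
      rw [← mul_assoc, ← mul_assoc, apow_mul_algProj, mul_assoc, algProj_mul_apow, mul_smul_comm,
        smul_mul_assoc, smul_mul_assoc, smul_smul, mul_comm]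
    have hrel : relMod A σ ρ (toHS A (algProj σ a * X * algProj ρ b)) =
        ((a * b ^ (-1 : ℝ) : ℝ) : ℂ) • toHS A (algProj σ a * X * algProj ρ b) := by
      have h1 : relMod A σ ρ (toHS A (algProj σ a * X * algProj ρ b)) =
        toHS A (σ * ((algProj σ a * X * algProj ρ b) * apow ρ (-1))) := rfl
      have h2 := gen 1 (-1)
      rw [hσ1, Real.rpow_one, mul_assoc σ] at h2
      rw [h1, h2, ← map_smul]
      rfl
    rw [cfc_apply_of_eigenvector (isPositive_relMod hσ hρ).isSelfAdjoint _ hrel, gen,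
      Real.mul_rpow ha0 (by positivity), ← Real.rpow_mul hb0.le, neg_one_mul, ← map_smul]
    rfl
  have hX : X = ∑ b ∈ (Matrix.finite_real_spectrum (A := (ρ : Matrix n n ℂ))).toFinset,
      ∑ a ∈ (Matrix.finite_real_spectrum (A := (σ : Matrix n n ℂ))).toFinset,
        algProj σ a * X * algProj ρ b := by
    simp_rw [← Finset.sum_mul, ← Finset.mul_sum]
    rw [sum_algProj σ hσ.isHermitian, sum_algProj ρ hρ.isHermitian, one_mul, mul_one]
  rw [hX]
  simp only [map_sum, Finset.mul_sum, Finset.sum_mul]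
  exact Finset.sum_congr rfl fun b hb => Finset.sum_congr rfl fun a ha => key a ha b hb

theorem quasiEntropy_powFun (ρ σ : A) (α : ℝ) : quasiEntropy A (powFun α) ρ σ =
      -(inner ℂ (toHS A (apow ρ (1 / 2)))
        (cfc (fun t : ℝ => t ^ α) (relMod A σ ρ) (toHS A (apow ρ (1 / 2))))).re := by
  have h : cfc (powFun α) (relMod A σ ρ) = -cfc (fun t : ℝ => t ^ α) (relMod A σ ρ) :=
    cfc_neg _ _
  rw [quasiEntropy, h, neg_apply, inner_neg_right, Complex.neg_re]

theorem quasiEntropy_powFun_eq_trace {σ ρ : A} (hσ : (σ : Matrix n n ℂ).PosSemidef)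
    (hρ : (ρ : Matrix n n ℂ).PosDef) (α : ℝ) : (quasiEntropy A (powFun α) ρ σ : ℂ) =
      -(mpow (ρ : Matrix n n ℂ) (1 - α) * mpow (σ : Matrix n n ℂ) α).trace := by
  have h1 : inner ℂ (toHS A (apow ρ (1 / 2)))
      (cfc (fun t : ℝ => t ^ α) (relMod A σ ρ) (toHS A (apow ρ (1 / 2)))) =
      (mpow (ρ : Matrix n n ℂ) (1 - α) * mpow (σ : Matrix n n ℂ) α).trace := by
    rw [cfc_rpow_relMod hσ hρ, inner_eq_trace]
    change ((mpow (ρ : Matrix n n ℂ) (1 / 2))ᴴ * (mpow (σ : Matrix n n ℂ) α *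
      mpow (ρ : Matrix n n ℂ) (1 / 2) * mpow (ρ : Matrix n n ℂ) (-α))).trace = _
    rw [conjTranspose_mpow, Matrix.mul_assoc, mpow_mul_mpow hρ, Matrix.trace_mul_comm,
      Matrix.mul_assoc, mpow_mul_mpow hρ, Matrix.trace_mul_comm]
    congr 3
    ring
  have h2 : star (mpow (ρ : Matrix n n ℂ) (1 - α) * mpow (σ : Matrix n n ℂ) α).trace =
      (mpow (ρ : Matrix n n ℂ) (1 - α) * mpow (σ : Matrix n n ℂ) α).trace := by
    rw [← Matrix.trace_conjTranspose, Matrix.conjTranspose_mul, conjTranspose_mpow,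
      conjTranspose_mpow, Matrix.trace_mul_comm]
  rw [quasiEntropy_powFun, h1, Complex.ofReal_neg]
  exact congrArg Neg.neg (Complex.conj_eq_iff_re.1 h2)

end HilbertSchmidt

/-! ### Positivity of the conditional expectation -/

section CondExp

variable {n : Type*} [Fintype n] [DecidableEq n] {M N : StarSubalgebra ℂ (Matrix n n ℂ)}

theorem trace_mul_condExp (hNM : N ≤ M) (X : M) {Y : Matrix n n ℂ} (hY : Y ∈ N) :
    (Y * (condExp M N X : Matrix n n ℂ)).trace = (Y * (X : Matrix n n ℂ)).trace := by
  have hY' : Yᴴ ∈ N := star_mem hY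
  have hmem : toHS M ⟨Yᴴ, hNM hY'⟩ ∈ hsSub M N := hY'
  have h := (hsSub M N).inner_right_of_mem_orthogonal hmem
    ((hsSub M N).sub_starProjection_mem_orthogonal (toHS M X))
  rw [inner_sub_right, sub_eq_zero, inner_eq_trace, inner_eq_trace, toMat_toHS,
    Matrix.conjTranspose_conjTranspose] at h
  exact h.symm

theorem eq_zero_of_trace_mul_eq_zero {Z : Matrix n n ℂ} (hZ : Z ∈ N)
    (h : ∀ Y ∈ N, (Y * Z).trace = 0) : Z = 0 :=
  Matrix.trace_conjTranspose_mul_self_eq_zero_iff.1 (h Zᴴ (star_mem hZ))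

theorem isHermitian_condExp (hNM : N ≤ M) {X : M} (hX : (X : Matrix n n ℂ).IsHermitian) :
    (condExp M N X : Matrix n n ℂ).IsHermitian := by
  have hmem : (condExp M N X : Matrix n n ℂ) ∈ N := (condExp M N X).2
  have hstar : (condExp M N X : Matrix n n ℂ)ᴴ ∈ N := star_mem hmem
  refine sub_eq_zero.1 (eq_zero_of_trace_mul_eq_zero (N := N) (sub_mem hstar hmem)
    fun Y hY => ?_)
  have hY' : Yᴴ ∈ N := star_mem hY
  have h1 : (Y * (condExp M N X : Matrix n n ℂ)ᴴ).trace = (Y * (X : Matrix n n ℂ)).trace := by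
    have h2 := congrArg star (trace_mul_condExp hNM X hY')
    rw [← Matrix.trace_conjTranspose, ← Matrix.trace_conjTranspose, Matrix.conjTranspose_mul,
      Matrix.conjTranspose_mul, Matrix.conjTranspose_conjTranspose, hX.eq,
      Matrix.trace_mul_comm, Matrix.trace_mul_comm _ Y] at h2
    exact h2
  rw [Matrix.mul_sub, Matrix.trace_sub, h1, trace_mul_condExp hNM X hY, sub_self]

/-- Pairing with the spectral projection of the conditional expectation for a set of nonpositive
reals. -/
theorem cfc_indicator_condExp (hNM : N ≤ M) {X : M} (hX : (X : Matrix n n ℂ).PosSemidef)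
    {s : Set ℝ} (hs : ∀ t ∈ s, t ≤ 0) :
    cfc (s.indicator fun t : ℝ => t) (condExp M N X : Matrix n n ℂ) = 0 ∧
    ((X : Matrix n n ℂ) *
      cfc (s.indicator fun _ : ℝ => (1 : ℝ)) (condExp M N X : Matrix n n ℂ)).trace = 0 := by
  set Z := (condExp M N X : Matrix n n ℂ) with hZ
  have hZh : Z.IsHermitian := isHermitian_condExp hNM hX.isHermitian
  set Q := cfc (s.indicator fun _ : ℝ => (1 : ℝ)) Z with hQ
  have hQN : Q ∈ N := cfc_mem_of_mem (condExp M N X).2 _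
  have hQh : Qᴴ = Q := cfc_predicate (p := IsSelfAdjoint) _ Z
  have hQQ : Q * Q = Q := by
    rw [hQ, ← cfc_mul _ _ _ (continuousOn_real_spectrum _ _) (continuousOn_real_spectrum _ _)]
    refine cfc_congr fun t _ => ?_
    by_cases h : t ∈ s <;> simp [h]
  have hQZ : Q * Z = cfc (s.indicator fun t : ℝ => t) Z := by
    have hZid : cfc (fun t : ℝ => t) Z = Z := cfc_id' ℝ Z (show IsSelfAdjoint Z from hZh)
    have h1 : Q * Z = Q * cfc (fun t : ℝ => t) Z := by rw [hZid]
    rw [h1, hQ, ← cfc_mul _ _ _ (continuousOn_real_spectrum _ _) (continuousOn_real_spectrum _ _)]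
    refine cfc_congr fun t _ => ?_
    by_cases h : t ∈ s <;> simp [h]
  -- A square root of `-QZ`, which is positive because `s` contains only nonpositive reals.
  set B := cfc (fun t : ℝ => √(-(s.indicator (fun t : ℝ => t) t))) Z with hB
  have hBh : Bᴴ = B := cfc_predicate (p := IsSelfAdjoint) _ Z
  have hBB : Bᴴ * B = -(Q * Z) := by
    rw [hBh, hQZ, hB, ← cfc_mul _ _ _ (continuousOn_real_spectrum _ _)
      (continuousOn_real_spectrum _ _), ← cfc_neg]
    refine cfc_congr fun t _ => Real.mul_self_sqrt ?_
    by_cases h : t ∈ s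
    · simpa [h] using hs t h
    · simp [h]
  have htr : (Q * Z).trace = (Q * (X : Matrix n n ℂ)).trace := trace_mul_condExp hNM X hQN
  have h1 : (0 : ℂ) ≤ (Q * (X : Matrix n n ℂ)).trace := by
    have := (hX.conjTranspose_mul_mul_same Q).trace_nonneg
    rwa [hQh, Matrix.trace_mul_comm, ← Matrix.mul_assoc, hQQ] at this
  have h2 : (0 : ℂ) ≤ -(Q * Z).trace := by
    rw [← Matrix.trace_neg, ← hBB]
    exact (Matrix.posSemidef_conjTranspose_mul_self B).trace_nonneg
  -- Positivity of `X` makes `Tr (QZ) = Tr (QX)` nonnegative, while `B* B = -QZ` makes it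
  -- nonpositive.
  have h3 : (Q * Z).trace = 0 := le_antisymm (neg_nonneg.1 h2) (htr ▸ h1)
  have hB0 : B = 0 := by
    rw [← Matrix.trace_conjTranspose_mul_self_eq_zero_iff, hBB, Matrix.trace_neg, h3, neg_zero]
  refine ⟨?_, ?_⟩
  · rw [← hQZ, ← neg_eq_zero, ← hBB, hB0, Matrix.mul_zero]
  · rw [Matrix.trace_mul_comm, ← htr, h3]

theorem posSemidef_condExp (hNM : N ≤ M) {X : M} (hX : (X : Matrix n n ℂ).PosSemidef) :
    (condExp M N X : Matrix n n ℂ).PosSemidef := by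
  have hZh := isHermitian_condExp hNM hX.isHermitian
  have hZs : IsSelfAdjoint (condExp M N X : Matrix n n ℂ) := hZh
  rw [hZh.posSemidef_iff_eigenvalues_nonneg]
  intro i
  by_contra hi
  have hi' : hZh.eigenvalues i < 0 := not_le.1 hi
  have h := (cfc_indicator_condExp hNM hX (s := Set.Iio 0) fun t ht => le_of_lt ht).1
  rw [← cfc_const_zero ℝ (condExp M N X : Matrix n n ℂ), cfc_eq_cfc_iff_eqOn hZs (continuousOn_real_spectrum _ _)
    (continuousOn_real_spectrum _ _)] at h
  have := h (hZh.eigenvalues_mem_spectrum_real i)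
  rw [Set.indicator_of_mem (Set.mem_Iio.2 hi')] at this
  exact hi'.ne this

/-- The eigenvalue `0` must be excluded too, so the trace identity is used: `Tr (XQ) = 0` gives
`X^{1/2} Q = 0`, and invertibility of `X^{1/2}` gives `Q = 0`. -/
theorem posDef_condExp (hNM : N ≤ M) {X : M} (hX : (X : Matrix n n ℂ).PosDef) :
    (condExp M N X : Matrix n n ℂ).PosDef := by
  have hZh := isHermitian_condExp hNM hX.isHermitian
  have hZs : IsSelfAdjoint (condExp M N X : Matrix n n ℂ) := hZh
  rw [hZh.posDef_iff_eigenvalues_pos]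
  intro i
  by_contra hi
  have h := (cfc_indicator_condExp hNM hX.posSemidef (s := Set.Iic 0) fun t ht => ht).2
  set Q := cfc ((Set.Iic 0).indicator fun _ : ℝ => (1 : ℝ))
    (condExp M N X : Matrix n n ℂ) with hQ
  have hQh : Qᴴ = Q := cfc_predicate (p := IsSelfAdjoint) _ _
  have hQQ : Q * Q = Q := by
    rw [hQ, ← cfc_mul _ _ _ (continuousOn_real_spectrum _ _) (continuousOn_real_spectrum _ _)]
    refine cfc_congr fun t _ => ?_
    by_cases h : t ∈ Set.Iic (0 : ℝ) <;> simp [h]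
  have hQ0 : Q = 0 := by
    have e1 : mpow (X : Matrix n n ℂ) (1 / 2) * mpow (X : Matrix n n ℂ) (1 / 2) = X := by
      rw [mpow_mul_mpow hX, add_halves, mpow_one hX.isHermitian]
    have e2 : mpow (X : Matrix n n ℂ) (1 / 2) * Q = 0 := by
      rw [← Matrix.trace_conjTranspose_mul_self_eq_zero_iff, Matrix.conjTranspose_mul, hQh,
        conjTranspose_mpow, Matrix.mul_assoc, ← Matrix.mul_assoc _ _ Q, e1,
        Matrix.trace_mul_comm, Matrix.mul_assoc, hQQ, h]
    have e3 : mpow (X : Matrix n n ℂ) (-(1 / 2)) * mpow (X : Matrix n n ℂ) (1 / 2) = 1 := by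
      rw [mpow_mul_mpow hX, neg_add_cancel, mpow_zero hX.isHermitian]
    rw [← Matrix.one_mul Q, ← e3, Matrix.mul_assoc, e2, Matrix.mul_zero]
  rw [hQ, ← cfc_const_zero ℝ (condExp M N X : Matrix n n ℂ),
    cfc_eq_cfc_iff_eqOn hZs (continuousOn_real_spectrum _ _)
    (continuousOn_real_spectrum _ _)] at hQ0
  have := hQ0 (hZh.eigenvalues_mem_spectrum_real i)
  rw [Set.indicator_of_mem (Set.mem_Iic.2 (not_lt.1 hi))] at this
  exact one_ne_zero this

end CondExp

/-! ### The isometry from `N` to `M` and the compression identity -/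

section Embedding

variable {n : Type*} [Fintype n] [DecidableEq n] {M N : StarSubalgebra ℂ (Matrix n n ℂ)}

/-- The map `X ↦ X ρ_N^{-1/2} ρ^{1/2}` from the Hilbert-Schmidt space of `N` to that of `M`. -/
noncomputable def embedLinear (hNM : N ≤ M) (ρ : M) : HS N →ₗ[ℂ] HS M :=
  (toHS M).toLinearMap ∘ₗ
    LinearMap.mulRight ℂ
      (StarSubalgebra.inclusion hNM (apow (condExp M N ρ) (-(1 / 2))) * apow ρ (1 / 2)) ∘ₗ
    (StarSubalgebra.inclusion hNM).toAlgHom.toLinearMap ∘ₗ (toHS N).symm.toLinearMap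

theorem toMat_embedLinear (hNM : N ≤ M) (ρ : M) (x : HS N) : toMat M (embedLinear hNM ρ x) =
    toMat N x * (mpow (condExp M N ρ : Matrix n n ℂ) (-(1 / 2)) *
      mpow (ρ : Matrix n n ℂ) (1 / 2)) := rfl

/-- Cyclicity collects the outer factors into `ρ`, traced against an element of `N`; so `ρ` may be
replaced by `ρ_N`, which `ρ_N^{-1/2}` on either side cancels. -/
theorem inner_embedLinear (hNM : N ≤ M) {ρ : M} (hρ : (ρ : Matrix n n ℂ).PosDef) (x y : HS N) :
    inner ℂ (embedLinear hNM ρ x) (embedLinear hNM ρ y) = inner ℂ x y := by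
  have hτ := posDef_condExp hNM hρ
  have hmem : mpow (condExp M N ρ : Matrix n n ℂ) (-(1 / 2)) ∈ N := mpow_mem (condExp M N ρ).2 _
  have htr := trace_mul_condExp hNM ρ (mul_mem (mul_mem hmem (star_mem (toMat_mem N x)))
    (mul_mem (toMat_mem N y) hmem))
  set B := mpow (condExp M N ρ : Matrix n n ℂ) (-(1 / 2)) with hB
  set C := mpow (ρ : Matrix n n ℂ) (1 / 2) with hC
  have hBh : Bᴴ = B := conjTranspose_mpow _ _
  have hCh : Cᴴ = C := conjTranspose_mpow _ _
  have hCC : C * C = (ρ : Matrix n n ℂ) := by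
    rw [hC, mpow_mul_mpow hρ, add_halves, mpow_one hρ.isHermitian]
  have hBτB : B * (condExp M N ρ : Matrix n n ℂ) * B = 1 := by
    have h1 : B * (condExp M N ρ : Matrix n n ℂ) * B =
        B * mpow (condExp M N ρ : Matrix n n ℂ) 1 * B := by rw [mpow_one hτ.isHermitian]
    rw [h1, hB, mpow_mul_mpow hτ, mpow_mul_mpow hτ, ← mpow_zero hτ.isHermitian]
    norm_num
  rw [inner_eq_trace, inner_eq_trace, toMat_embedLinear, toMat_embedLinear,
    Matrix.conjTranspose_mul, Matrix.conjTranspose_mul, hBh, hCh]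
  set a := toMat N x
  set b := toMat N y
  calc (C * B * aᴴ * (b * (B * C))).trace = (B * aᴴ * (b * B) * (C * C)).trace := by
        rw [Matrix.mul_assoc C, Matrix.mul_assoc C, Matrix.trace_mul_comm C]
        simp only [Matrix.mul_assoc]
    _ = (B * aᴴ * (b * B) * (condExp M N ρ : Matrix n n ℂ)).trace := by rw [hCC]; exact htr.symm
    _ = (aᴴ * b * (B * (condExp M N ρ : Matrix n n ℂ) * B)).trace := by
        rw [Matrix.mul_assoc B, Matrix.mul_assoc B, Matrix.trace_mul_comm B]
        simp only [Matrix.mul_assoc]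
    _ = (aᴴ * b).trace := by rw [hBτB, Matrix.mul_one]

/-- Here `ρ^{1/2} ρ⁻¹ ρ^{1/2} = 1` removes `ρ` altogether, and `σ` is left traced against an element
of `N`, so it may be replaced by `σ_N`. -/
theorem inner_embedLinear_relMod (hNM : N ≤ M) {ρ : M} (hρ : (ρ : Matrix n n ℂ).PosDef) (σ : M)
    (x y : HS N) :
    inner ℂ (embedLinear hNM ρ x) (relMod M σ ρ (embedLinear hNM ρ y)) =
      inner ℂ x (relMod N (condExp M N σ) (condExp M N ρ) y) := by
  have hτ := posDef_condExp hNM hρ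
  have hmem : mpow (condExp M N ρ : Matrix n n ℂ) (-1) ∈ N := mpow_mem (condExp M N ρ).2 _
  have htr := trace_mul_condExp hNM σ (mul_mem (mul_mem (toMat_mem N y) hmem)
    (star_mem (toMat_mem N x)))
  rw [inner_eq_trace, inner_eq_trace, toMat_relMod, toMat_relMod, toMat_embedLinear,
    toMat_embedLinear, Matrix.conjTranspose_mul, Matrix.conjTranspose_mul, conjTranspose_mpow,
    conjTranspose_mpow]
  set B := mpow (condExp M N ρ : Matrix n n ℂ) (-(1 / 2)) with hB
  set C := mpow (ρ : Matrix n n ℂ) (1 / 2) with hC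
  set E := mpow (ρ : Matrix n n ℂ) (-1) with hE
  have hBB : B * B = mpow (condExp M N ρ : Matrix n n ℂ) (-1) := by
    rw [hB, mpow_mul_mpow hτ]; norm_num
  have hCEC : C * E * C = 1 := by
    rw [hC, hE, mpow_mul_mpow hρ, mpow_mul_mpow hρ, ← mpow_zero hρ.isHermitian]
    norm_num
  rw [← hBB] at htr ⊢
  set a := toMat N x
  set b := toMat N y
  calc (C * B * aᴴ * ((σ : Matrix n n ℂ) * (b * (B * C) * E))).trace
      = (B * aᴴ * (σ : Matrix n n ℂ) * b * B * (C * E * C)).trace := by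
        rw [Matrix.mul_assoc C, Matrix.mul_assoc C, Matrix.trace_mul_comm C]
        simp only [Matrix.mul_assoc]
    _ = (b * (B * B) * aᴴ * (σ : Matrix n n ℂ)).trace := by
        rw [hCEC, Matrix.mul_one, Matrix.mul_assoc, Matrix.trace_mul_comm]
        simp only [Matrix.mul_assoc]
    _ = (b * (B * B) * aᴴ * (condExp M N σ : Matrix n n ℂ)).trace := htr.symm
    _ = (aᴴ * ((condExp M N σ : Matrix n n ℂ) * (b * (B * B)))).trace := by
        rw [Matrix.mul_assoc, Matrix.trace_mul_comm]
        simp only [Matrix.mul_assoc]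

/-- The isometry `X ↦ X ρ_N^{-1/2} ρ^{1/2}` from the Hilbert-Schmidt space of `N` to that
of `M`. -/
noncomputable def embed (hNM : N ≤ M) {ρ : M} (hρ : (ρ : Matrix n n ℂ).PosDef) : HS N →ₗᵢ[ℂ] HS M :=
  (embedLinear hNM ρ).isometryOfInner (inner_embedLinear hNM hρ)

theorem embed_toHS_sqrt (hNM : N ≤ M) {ρ : M} (hρ : (ρ : Matrix n n ℂ).PosDef) :
    embed hNM hρ (toHS N (apow (condExp M N ρ) (1 / 2))) = toHS M (apow ρ (1 / 2)) := by
  have hτ := posDef_condExp hNM hρ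
  refine toMat_injective M ?_
  change mpow (condExp M N ρ : Matrix n n ℂ) (1 / 2) *
    (mpow (condExp M N ρ : Matrix n n ℂ) (-(1 / 2)) * mpow (ρ : Matrix n n ℂ) (1 / 2)) =
    mpow (ρ : Matrix n n ℂ) (1 / 2)
  rw [← Matrix.mul_assoc, mpow_mul_mpow hτ, add_neg_cancel, mpow_zero hτ.isHermitian,
    Matrix.one_mul]

theorem norm_toHS_sqrt {ρ : M} (hρ : (ρ : Matrix n n ℂ).PosDef)
    (htr : (ρ : Matrix n n ℂ).trace = 1) : ‖toHS M (apow ρ (1 / 2))‖ = 1 := by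
  rw [norm_eq_hsNorm, hsNorm, toMat_toHS]
  change √((mpow (ρ : Matrix n n ℂ) (1 / 2))ᴴ * mpow (ρ : Matrix n n ℂ) (1 / 2)).trace.re = 1
  rw [conjTranspose_mpow, mpow_mul_mpow hρ, add_halves, mpow_one hρ.isHermitian, htr]
  simp

theorem norm_embed_cfc_sub (hNM : N ≤ M) {ρ σ : M} (hρ : (ρ : Matrix n n ℂ).PosDef)
    (hσ : (σ : Matrix n n ℂ).PosSemidef) (β : ℝ) :
    ‖embed hNM hρ (cfc (fun t : ℝ => t ^ β) (relMod N (condExp M N σ) (condExp M N ρ))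
        (toHS N (apow (condExp M N ρ) (1 / 2)))) -
      cfc (fun t : ℝ => t ^ β) (relMod M σ ρ)
        (embed hNM hρ (toHS N (apow (condExp M N ρ) (1 / 2))))‖ =
    hsNorm (mpow (condExp M N σ : Matrix n n ℂ) β * mpow (condExp M N ρ : Matrix n n ℂ) (-β) *
        mpow (ρ : Matrix n n ℂ) (1 / 2) -
      mpow (σ : Matrix n n ℂ) β * mpow (ρ : Matrix n n ℂ) (1 / 2 - β)) := by
  have hτ := posDef_condExp hNM hρ
  rw [embed_toHS_sqrt, cfc_rpow_relMod (posSemidef_condExp hNM hσ) hτ, cfc_rpow_relMod hσ hρ,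
    norm_eq_hsNorm, map_sub]
  congr 1
  change mpow (condExp M N σ : Matrix n n ℂ) β * mpow (condExp M N ρ : Matrix n n ℂ) (1 / 2) *
      mpow (condExp M N ρ : Matrix n n ℂ) (-β) *
      (mpow (condExp M N ρ : Matrix n n ℂ) (-(1 / 2)) * mpow (ρ : Matrix n n ℂ) (1 / 2)) -
    mpow (σ : Matrix n n ℂ) β * mpow (ρ : Matrix n n ℂ) (1 / 2) * mpow (ρ : Matrix n n ℂ) (-β) = _
  rw [Matrix.mul_assoc (mpow (σ : Matrix n n ℂ) β), mpow_mul_mpow hρ, ← sub_eq_add_neg]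
  congr 1
  rw [← Matrix.mul_assoc]
  congr 1
  rw [Matrix.mul_assoc, Matrix.mul_assoc, mpow_mul_mpow hτ, mpow_mul_mpow hτ]
  congr 2
  ring

end Embedding

end QuasiEntropy

/-! ### The main theorem -/

theorem corollary5p2 {n : Type*} [Fintype n] [DecidableEq n]
    (M N : StarSubalgebra ℂ (Matrix n n ℂ)) (hNM : N ≤ M)
    (ρ σ : M)
    (hρ : QuasiEntropy.IsDensity (ρ : Matrix n n ℂ))
    (hσ : QuasiEntropy.IsDensity (σ : Matrix n n ℂ))
    (hρinv : IsUnit (ρ : Matrix n n ℂ))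
    (α : ℝ) (hα : α ∈ Set.Ioo (0 : ℝ) 1) :
    let ρN : N := QuasiEntropy.condExp M N ρ
    let σN : N := QuasiEntropy.condExp M N σ
    let D : ℝ := ‖QuasiEntropy.relMod M σ ρ‖
    let gap : ℝ := QuasiEntropy.quasiEntropy M (QuasiEntropy.powFun α) ρ σ -
      QuasiEntropy.quasiEntropy N (QuasiEntropy.powFun α) ρN σN
    ((QuasiEntropy.quasiEntropy M (QuasiEntropy.powFun α) ρ σ : ℂ) =
      -(QuasiEntropy.mpow (ρ : Matrix n n ℂ) (1 - α) *
        QuasiEntropy.mpow (σ : Matrix n n ℂ) α).trace) ∧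
    (∀ β ∈ Set.Ioo (0 : ℝ) (1 / 2),
      QuasiEntropy.KL α β D *
        QuasiEntropy.hsNorm
          (QuasiEntropy.mpow (σN : Matrix n n ℂ) β * QuasiEntropy.mpow (ρN : Matrix n n ℂ) (-β) *
              QuasiEntropy.mpow (ρ : Matrix n n ℂ) (1 / 2) -
            QuasiEntropy.mpow (σ : Matrix n n ℂ) β *
              QuasiEntropy.mpow (ρ : Matrix n n ℂ) (1 / 2 - β)) ^
          ((1 + α * (1 - β)) / (β * (1 - β))) ≤ gap) ∧
    (∀ β ∈ Set.Ico (1 / 2 : ℝ) 1,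
      QuasiEntropy.KU α β D *
        QuasiEntropy.hsNorm
          (QuasiEntropy.mpow (σN : Matrix n n ℂ) β * QuasiEntropy.mpow (ρN : Matrix n n ℂ) (-β) *
              QuasiEntropy.mpow (ρ : Matrix n n ℂ) (1 / 2) -
            QuasiEntropy.mpow (σ : Matrix n n ℂ) β *
              QuasiEntropy.mpow (ρ : Matrix n n ℂ) (1 / 2 - β)) ^
          ((2 * β + α * (1 - β)) / (β * (1 - β))) ≤ gap) ∧
    (QuasiEntropy.KU α (1 / 2) D *
        QuasiEntropy.hsNorm
          (QuasiEntropy.mpow (σN : Matrix n n ℂ) (1 / 2) *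
              QuasiEntropy.mpow (ρN : Matrix n n ℂ) (-(1 / 2)) *
              QuasiEntropy.mpow (ρ : Matrix n n ℂ) (1 / 2) -
            QuasiEntropy.mpow (σ : Matrix n n ℂ) (1 / 2)) ^ (4 + 2 * α) ≤ gap) ∧
    QuasiEntropy.KU α (1 / 2) D = QuasiEntropy.KL α (1 / 2) D := by
  intro ρN σN D gap
  have hρd : (ρ : Matrix n n ℂ).PosDef := hρ.1.posDef_iff_isUnit.2 hρinv
  have hτ : (ρN : Matrix n n ℂ).PosDef := QuasiEntropy.posDef_condExp hNM hρd
  have hσN : (σN : Matrix n n ℂ).PosSemidef := QuasiEntropy.posSemidef_condExp hNM hσ.1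
  have hT := QuasiEntropy.isPositive_relMod hσ.1 hρd
  have hS := QuasiEntropy.isPositive_relMod hσN hτ
  have hTS : ∀ x y, inner ℂ (QuasiEntropy.embed hNM hρd x)
      (QuasiEntropy.relMod M σ ρ (QuasiEntropy.embed hNM hρd y)) =
      inner ℂ x (QuasiEntropy.relMod N σN ρN y) :=
    QuasiEntropy.inner_embedLinear_relMod hNM hρd σ
  have hv := QuasiEntropy.embed_toHS_sqrt hNM hρd
  have hnorm : ‖QuasiEntropy.toHS N (QuasiEntropy.apow ρN (1 / 2))‖ = 1 := by
    rw [← (QuasiEntropy.embed hNM hρd).norm_map, hv, QuasiEntropy.norm_toHS_sqrt hρd hρ.2]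
  -- The sign in `powFun` reverses the order: the gap is the `N`-term of `t^α` minus the `M`-term.
  have hgap : gap = (inner ℂ (QuasiEntropy.toHS N (QuasiEntropy.apow ρN (1 / 2)))
      (cfc (fun t : ℝ => t ^ α) (QuasiEntropy.relMod N σN ρN)
        (QuasiEntropy.toHS N (QuasiEntropy.apow ρN (1 / 2))))).re -
      (inner ℂ (QuasiEntropy.embed hNM hρd (QuasiEntropy.toHS N (QuasiEntropy.apow ρN (1 / 2))))
        (cfc (fun t : ℝ => t ^ α) (QuasiEntropy.relMod M σ ρ)
          (QuasiEntropy.embed hNM hρd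
            (QuasiEntropy.toHS N (QuasiEntropy.apow ρN (1 / 2)))))).re := by
    rw [hv]
    simp only [gap]
    rw [QuasiEntropy.quasiEntropy_powFun, QuasiEntropy.quasiEntropy_powFun]
    ring
  have hU : ∀ β ∈ Set.Ico (1 / 2 : ℝ) 1,
      QuasiEntropy.KU α β D *
        QuasiEntropy.hsNorm
          (QuasiEntropy.mpow (σN : Matrix n n ℂ) β * QuasiEntropy.mpow (ρN : Matrix n n ℂ) (-β) *
              QuasiEntropy.mpow (ρ : Matrix n n ℂ) (1 / 2) -
            QuasiEntropy.mpow (σ : Matrix n n ℂ) β *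
              QuasiEntropy.mpow (ρ : Matrix n n ℂ) (1 / 2 - β)) ^
          ((2 * β + α * (1 - β)) / (β * (1 - β))) ≤ gap := by
    intro β hβ
    rw [hgap, ← QuasiEntropy.norm_embed_cfc_sub hNM hρd hσ.1 β]
    exact KU_mul_rpow_norm_le hT hS hTS hα hβ hnorm
  refine ⟨QuasiEntropy.quasiEntropy_powFun_eq_trace hσ.1 hρd α, fun β hβ => ?_, hU, ?_, ?_⟩
  · rw [hgap, ← QuasiEntropy.norm_embed_cfc_sub hNM hρd hσ.1 β]
    exact KL_mul_rpow_norm_le hT hS hTS hα hβ hnorm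
  · have h := hU (1 / 2) ⟨le_rfl, by norm_num⟩
    rw [sub_self, QuasiEntropy.mpow_zero hρd.isHermitian, Matrix.mul_one,
      show (2 * (1 / 2) + α * (1 - 1 / 2)) / (1 / 2 * (1 - 1 / 2)) = 4 + 2 * α by ring] at h
    exact h
  -- At `β = 1/2` the parameters `q` and `s` agree, so the two constants coincide.
  · have e1 : α * (1 - 1 / 2) + 1 - 2 * (1 / 2) + 2 * (1 / 2) ^ 2 =
        2 * (1 / 2) ^ 2 + α * (1 - 1 / 2) := by ring
    simp only [QuasiEntropy.KU, QuasiEntropy.KL, e1]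
    norm_num
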